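/- Model. For $n=2^J$, $J\to\infty$, let $X_t=\alpha(t/n)+\varepsilon_t$ ($t=1,\dots,n$) be independent, nonnegative, with $\mathbb E X_t=\alpha(t/n)$ and $\operatorname{Var}X_t=h(\alpha(t/n))$ (the law may depend on $n$). For $\epsilon\in(0,1/3]$ put $\mathcal I_n=\{(j,k)\in\mathbb Z^2: 1\le k\le 2^j,\ 0\le j\le J^*-1\}$, $2^{J^*}=n^{1-\epsilon}$. For a half-width $M=M_n\in\mathbb N$, a bandwidth $b=b_n>0$ and a kernel $K$ let $$\hat\alpha_t=\frac1{2M+1}\sum_{p=t-M}^{t+M}X_p,\qquad \hat h(u)=\frac{\sum_{t=1}^n K\big((\hat\alpha_t-u)/b\big)(X_t-\hat\alpha_t)^2}{\sum_{t=1}^n K\big((\hat\alpha_t-u)/b\big)},$$ where $X_p$ with $p\notin\{1,\dots,n\}$ is given by any fixed boundary rule that replaces $p$ by an index in $\{1,\dots,n\}$ (periodic extension, reflection, …). Write $W_{nt}(u)=(nb)^{-1}K((\alpha(t/n)-u)/b)$, and let $\kappa_{j,k-q}$ be the weight of $X_q$ in the local mean at $(j,k)\in\mathcal I_n$. Assumptions.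 (1) $\alpha:[0,1]\to\mathbb R$ has finite total variation and $0<\underline\alpha=\inf\alpha\le\overline\alpha=\sup\alpha<\infty$. (2) $h:[0,\infty)\to[0,\infty)$ is non-decreasing; on $[\underline\alpha,\overline\alpha]$ it is bounded, bounded away from $0$, and Lipschitz; and some power $h^{s}$, $s>0$, is Hölder continuous on $[0,\infty)$ with some exponent $r>0$. (3) There are $K_0>0$, $\gamma\ge0$ with $\mathbb E|\varepsilon_t|^l\le (l!)^{1+\gamma}K_0^{l-2}h(\alpha(t/n))$ for all $l\ge3$, all $t$ and $n$. (5) $\kappa_{j,k-q}\ge0$, $\sum_q\kappa_{j,k-q}=1$, $\sum_q\kappa_{j,k-q}^2=O(2^{j-J})$ and $\max_q\kappa_{j,k-q}=O(2^{j-J})$, uniformly over $(j,k)\in\mathcal I_n$. (6) $K:\mathbb R\to[0,\infty)$ vanishes outside $[-1/2,1/2]$, is bounded, integrates to one and is Lipschitz. (7) $\operatorname{Var}(\varepsilon_t^2)\ge\underline c>0$ uniformly over $t$ and $n$. (8) There is $C_2>0$ with $\operatorname{Var}(\hat\alpha_t)\le C_2\operatorname{Var}|\hat\alpha_t-\mathbb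 E\hat\alpha_t|$, uniformly over $t$ and all large $n$. (9) There are $a,d>0$ with $P(\sup_{t\le n}|\varepsilon_t|\le a\log^d n)=1-O(n^{-2})$. (10) There is $c_1>0$ with $\sum_{t=1}^nW_{nt}(u)\ge c_1$ for all $u\in\operatorname{range}(\alpha)$ and all large $n$. (11) $\sum_q\kappa_{j,k-q}\alpha(q/n)\in\operatorname{range}(\alpha)$ for all $(j,k)\in\mathcal I_n$. Corollary 1. Suppose that these assumptions hold. Let $M$ be of exact order $n^{\vartheta}$ and $b$ of exact order $n^{-\zeta}$, where $(\epsilon,\vartheta,\zeta)$ lies in $$A=\{(\epsilon,\vartheta,\zeta):\epsilon\in(0,1/3],\ \zeta\in(0,\min(\vartheta/4,\ 1/2-\vartheta/2,\ \epsilon/4))\},$$ and let $\delta=\delta_n\ge c\log^{v}n$ for all large $n$, for some $c>0$ and $v<0$. Then there exists $\varsigma>0$ such that, uniformly over $(j,k)\in\mathcal I_n$, $$P\Big(\Big|\hat h\Big(\sum_q\kappa_{j,k-q}X_q\Big)-h\Big(\sum_q\kappa_{j,k-q}\,\alpha(q/n)\Big)\Big|\ge\delta\Big)= O\Big\{n^{\vartheta}\exp\Big(-\frac{n^{2\varsigma}}2\Big)+n^{-2}\Big\}.$$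 -/

import Mathlib

open MeasureTheory ProbabilityTheory Filter Asymptotics
open scoped NNReal

namespace WaveletFisz

noncomputable section

universe u

/-! ## The estimator (deterministic part, for one data vector `x 1, …, x n`) -/

/-- A boundary rule for a sample `1, …, n`: every integer `p` is replaced by an index
`pad p ∈ {1, …, n}`, and nothing is changed inside the sample. Periodic extension, reflection
and repetition of the end values are examples. -/
def IsBoundaryRule (n : ℕ) (pad : ℤ → ℕ) : Prop :=
  (∀ p : ℤ, 1 ≤ pad p ∧ pad p ≤ n) ∧ ∀ t : ℕ, 1 ≤ t → t ≤ n → pad (t : ℤ) = t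

/-- The preliminary estimator `α̂_t = (2M+1)⁻¹ ∑_{p=t-M}^{t+M} x_p`; the values `x_p` with `p`
outside the sample are read off by the boundary rule. -/
def prelim (M : ℕ) (pad : ℤ → ℕ) (x : ℕ → ℝ) (t : ℕ) : ℝ :=
  (∑ p ∈ Finset.Icc ((t : ℤ) - M) ((t : ℤ) + M), x (pad p)) / (2 * (M : ℝ) + 1)

/-- The kernel weight `(n b)⁻¹ K((a - u) / b)`. With `a = α(t/n)` this is `W_{nt}(u)`, with
`a = α̂_t` it is `Ŵ_{nt}(u)`. -/
def kernelWeight (K : ℝ → ℝ) (n : ℕ) (b a u : ℝ) : ℝ :=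
  1 / ((n : ℝ) * b) * K ((a - u) / b)

/-- The Nadaraya–Watson estimator `ĥ(u)` of the variance function, which smooths the squared
empirical residuals `(x_t - α̂_t)²`. -/
def hHat (K : ℝ → ℝ) (n M : ℕ) (b : ℝ) (pad : ℤ → ℕ) (x : ℕ → ℝ) (u : ℝ) : ℝ :=
  (∑ t ∈ Finset.Icc 1 n,
      kernelWeight K n b (prelim M pad x t) u * (x t - prelim M pad x t) ^ 2) /
    ∑ t ∈ Finset.Icc 1 n, kernelWeight K n b (prelim M pad x t) u

/-- The local mean `∑_{q=1}^n w_q x_q`. -/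
def localMean (n : ℕ) (w x : ℕ → ℝ) : ℝ :=
  ∑ q ∈ Finset.Icc 1 n, w q * x q

/-- The signal on the grid, `q ↦ α(q / n)`. -/
def gridValues (α : ℝ → ℝ) (n : ℕ) (q : ℕ) : ℝ := α ((q : ℝ) / n)

/-- The index set `𝓘_n` for `n = 2 ^ J`: pairs `(j, k)` with `1 ≤ k ≤ 2 ^ j` and
`0 ≤ j ≤ J* - 1`, where `2 ^ J* = n ^ (1 - ε)`, that is `J* = (1 - ε) J`. -/
def indexSet (ε : ℝ) (J : ℕ) : Set (ℕ × ℕ) :=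
  {p | 1 ≤ p.2 ∧ p.2 ≤ 2 ^ p.1 ∧ (p.1 : ℝ) ≤ (1 - ε) * J - 1}

/-- The set `A` of admissible triples `(ε, ϑ, ζ)`. -/
def admissible : Set (ℝ × ℝ × ℝ) :=
  {p | p.1 ∈ Set.Ioc 0 (1 / 3) ∧
    p.2.2 ∈ Set.Ioo 0 (min (p.2.1 / 4) (min (1 / 2 - p.2.1 / 2) (p.1 / 4)))}

/-! ## The signal and the variance function -/

/-- The range of `α : [0, 1] → ℝ`. -/
def signalRange (α : ℝ → ℝ) : Set ℝ := α '' Set.Icc 0 1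

/-- `inf α` and `sup α` over `[0, 1]` span this interval. -/
def signalHull (α : ℝ → ℝ) : Set ℝ := Set.Icc (sInf (signalRange α)) (sSup (signalRange α))

/-- `α` has finite total variation on `[0, 1]` and `0 < inf α ≤ sup α < ∞`. -/
structure SignalAssumption (α : ℝ → ℝ) : Prop where
  boundedVariation : BoundedVariationOn α (Set.Icc 0 1)
  bddBelow : BddBelow (signalRange α)
  inf_pos : 0 < sInf (signalRange α)
  bddAbove : BddAbove (signalRange α)

/-- The assumption on the variance function `h : [0, ∞) → [0, ∞)`. -/
structure VarianceFunctionAssumption (α h : ℝ → ℝ) : Prop where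
  nonneg : ∀ u, 0 ≤ u → 0 ≤ h u
  inf_pos : 0 < sInf (h '' signalHull α)
  bddAbove : BddAbove (h '' signalHull α)
  monotone : MonotoneOn h (Set.Ici 0)
  lipschitz : ∃ H : ℝ≥0, LipschitzOnWith H h (signalHull α)
  power_holder : ∃ (s : ℝ) (r H : ℝ≥0), 0 < s ∧ 0 < r ∧ 0 < H ∧
    HolderOnWith H r (fun u => h u ^ s) (Set.Ici 0)

/-! ## The regression model; stage `J` has sample size `n = 2 ^ J` -/

section Model

variable {Ω : ℕ → Type u} [∀ J, MeasurableSpace (Ω J)]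

/-- The noise `ε_t = X_t - α(t/n)`, `n = 2 ^ J`. -/
def noise (α : ℝ → ℝ) (X : ∀ J, ℕ → Ω J → ℝ) (J t : ℕ) (ω : Ω J) : ℝ :=
  X J t ω - gridValues α (2 ^ J) t

/-- For each `J`, the observations `X_1, …, X_n` are independent, nonnegative, with mean
`α(t/n)` and (finite) variance `h(α(t/n))`. -/
structure IsRegressionModel (P : ∀ J, Measure (Ω J)) (X : ∀ J, ℕ → Ω J → ℝ)
    (α h : ℝ → ℝ) : Prop where
  measurable : ∀ J, ∀ t ∈ Finset.Icc 1 (2 ^ J), Measurable (X J t)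
  nonneg : ∀ J, ∀ t ∈ Finset.Icc 1 (2 ^ J), ∀ᵐ ω ∂(P J), 0 ≤ X J t ω
  indep : ∀ J, iIndepFun (fun t : Finset.Icc 1 (2 ^ J) => X J t) (P J)
  memLp : ∀ J, ∀ t ∈ Finset.Icc 1 (2 ^ J), MemLp (X J t) 2 (P J)
  mean : ∀ J, ∀ t ∈ Finset.Icc 1 (2 ^ J), ∫ ω, X J t ω ∂(P J) = gridValues α (2 ^ J) t
  variance : ∀ J, ∀ t ∈ Finset.Icc 1 (2 ^ J),
    variance (X J t) (P J) = h (gridValues α (2 ^ J) t)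

/-- `E|ε_t|^l ≤ (l!)^{1+γ} K₀^{l-2} h(α(t/n))` for `l = 3, 4, …` and all `t`. -/
def MomentAssumption (P : ∀ J, Measure (Ω J)) (X : ∀ J, ℕ → Ω J → ℝ) (α h : ℝ → ℝ) : Prop :=
  ∃ K₀ γ : ℝ, 0 < K₀ ∧ 0 ≤ γ ∧ ∀ J, ∀ t ∈ Finset.Icc 1 (2 ^ J), ∀ l : ℕ, 3 ≤ l →
    Integrable (fun ω => |noise α X J t ω| ^ l) (P J) ∧
    ∫ ω, |noise α X J t ω| ^ l ∂(P J) ≤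
      (l.factorial : ℝ) ^ (1 + γ) * K₀ ^ (l - 2) * h (gridValues α (2 ^ J) t)

/-- `Var(ε_t²) ≥ c > 0`, uniformly over `t` and `n`. -/
def SquaredNoiseAssumption (P : ∀ J, Measure (Ω J)) (X : ∀ J, ℕ → Ω J → ℝ)
    (α : ℝ → ℝ) : Prop :=
  ∃ c : ℝ, 0 < c ∧ ∀ J, ∀ t ∈ Finset.Icc 1 (2 ^ J),
    c ≤ variance (fun ω => noise α X J t ω ^ 2) (P J)

/-- `Var(α̂_t) ≤ C₂ Var|α̂_t - E α̂_t|`, uniformly over `t` and (large) `n`. -/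
def AbsoluteDeviationAssumption (P : ∀ J, Measure (Ω J)) (X : ∀ J, ℕ → Ω J → ℝ)
    (M : ℕ → ℕ) (pad : ℕ → ℤ → ℕ) : Prop :=
  ∃ C₂ : ℝ, 0 < C₂ ∧ ∀ᶠ J in atTop, ∀ t ∈ Finset.Icc 1 (2 ^ J),
    variance (fun ω => prelim (M J) (pad J) (fun s => X J s ω) t) (P J) ≤
      C₂ * variance (fun ω => |prelim (M J) (pad J) (fun s => X J s ω) t -
        ∫ ω', prelim (M J) (pad J) (fun s => X J s ω') t ∂(P J)|) (P J)

/-- `P(sup_t |ε_t| ≤ a log^d n) = 1 - O(n⁻²)` for some `a, d > 0`. -/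
def TailAssumption (P : ∀ J, Measure (Ω J)) (X : ∀ J, ℕ → Ω J → ℝ) (α : ℝ → ℝ) : Prop :=
  ∃ a d : ℝ, 0 < a ∧ 0 < d ∧
    (fun J : ℕ => 1 - (P J).real {ω | ∀ t ∈ Finset.Icc 1 (2 ^ J),
      |noise α X J t ω| ≤ a * Real.log ((2 : ℝ) ^ J) ^ d})
    =O[atTop] fun J : ℕ => (((2 : ℝ) ^ J) ^ 2)⁻¹

end Model

/-! ## Kernel, bandwidth and local weights -/

/-- The kernel `K` lives on `[-1/2, 1/2]`, is zero elsewhere, nonnegative, bounded, integrates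
to one and is Lipschitz continuous. -/
structure KernelAssumption (K : ℝ → ℝ) : Prop where
  support : ∀ z, z ∉ Set.Icc (-(1 / 2) : ℝ) (1 / 2) → K z = 0
  nonneg : ∀ z, 0 ≤ K z
  bounded : BddAbove (Set.range K)
  integral_one : ∫ z in (-(1 / 2) : ℝ)..(1 / 2), K z = 1
  lipschitz : ∃ L : ℝ≥0, LipschitzWith L K

/-- `∑_t W_{nt}(u) ≥ c₁ > 0`, uniformly over `u` in the range of `α` and over large `n`, with
the bandwidth `b` belonging to `n`. -/
def DesignAssumption (α K : ℝ → ℝ) (b : ℕ → ℝ) : Prop :=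
  ∃ c₁ : ℝ, 0 < c₁ ∧ ∀ᶠ J in atTop, ∀ u ∈ signalRange α,
    c₁ ≤ ∑ t ∈ Finset.Icc 1 (2 ^ J), kernelWeight K (2 ^ J) (b J) (gridValues α (2 ^ J) t) u

/-- The weights `κ J j k q` (the weight `κ_{j,k-q}` of `X_q` in the local mean at `(j, k)` when
`n = 2 ^ J`) are nonnegative, sum to one, and `∑_q κ² = O(2^{j-J})`, `max_q κ = O(2^{j-J})`,
uniformly over `𝓘_n`. -/
structure WeightAssumption (ε : ℝ) (κ : ℕ → ℕ → ℕ → ℕ → ℝ) : Prop where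
  nonneg : ∀ J, ∀ p ∈ indexSet ε J, ∀ q ∈ Finset.Icc 1 (2 ^ J), 0 ≤ κ J p.1 p.2 q
  sum_one : ∀ J, ∀ p ∈ indexSet ε J, ∑ q ∈ Finset.Icc 1 (2 ^ J), κ J p.1 p.2 q = 1
  sum_sq : ∃ C : ℝ, ∀ J, ∀ p ∈ indexSet ε J,
    ∑ q ∈ Finset.Icc 1 (2 ^ J), κ J p.1 p.2 q ^ 2 ≤ C * ((2 : ℝ) ^ p.1 / 2 ^ J)
  max_le : ∃ C : ℝ, ∀ J, ∀ p ∈ indexSet ε J, ∀ q ∈ Finset.Icc 1 (2 ^ J),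
    κ J p.1 p.2 q ≤ C * ((2 : ℝ) ^ p.1 / 2 ^ J)

/-- The local means of `α` lie in the range of `α`. -/
def LocalMeanAssumption (α : ℝ → ℝ) (ε : ℝ) (κ : ℕ → ℕ → ℕ → ℕ → ℝ) : Prop :=
  ∀ J, ∀ p ∈ indexSet ε J,
    localMean (2 ^ J) (κ J p.1 p.2) (gridValues α (2 ^ J)) ∈ signalRange α

end

end WaveletFisz

/-! Outside an event of probability O(n⁻²) every noise variable is at most L = a log^d n in modulus.
Truncating there moves each mean by O(1/n) only, and Hoeffding's inequality at level B√(6V log n),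
with B the truncated bound and V the sum of squared weights, fails with probability at most 2n⁻³
(`sample_concentration`). This is used for at most n interior moving averages, for the local mean
and for the kernel-smoothed squared noise, so a union bound costs O(n⁻²).

On the remaining event everything is deterministic (`abs_hHat_sub_le`). The Lipschitz kernel turns
the average error of α̂_t and the error of the local mean into an error E carrying a factor b⁻².
Averaging over t matters: α may jump, so the bias of α̂_t need not be small at every t, but for a
signal of bounded variation the biases sum to O(M) (`sum_abs_prelim_sub_le`).

Up to logarithms E has order b⁻²(M^(-1/2) + M/n + n^(-ε/2)), and the three bounds on ζ in
`admissible` make each term a negative power of n. The total error is then eventually below c log^v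
n ≤ δ, so the event in question lies in the exceptional one. -/

namespace WaveletFisz

/-! ### Hoeffding's inequality with truncation. -/

section Concentration

variable {Ω ι : Type*} [MeasurableSpace Ω] {μ : Measure Ω}

/-- The sub-Gaussian parameter may be enlarged. -/
lemma hasSubgaussianMGF_mono {Y : Ω → ℝ} {c c' : ℝ≥0} (h : HasSubgaussianMGF Y c μ)
    (hc : c ≤ c') : HasSubgaussianMGF Y c' μ where
  integrable_exp_mul := h.integrable_exp_mul
  mgf_le t := (h.mgf_le t).trans <| by
    have : (c : ℝ) ≤ c' := hc
    gcongr

/-- Hoeffding's inequality for weighted sums of independent bounded variables. -/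
lemma hoeffding_weighted [Fintype ι] [IsProbabilityMeasure μ] {Y : ι → Ω → ℝ} {w : ι → ℝ}
    {B V s : ℝ} (hY : ∀ i, Measurable (Y i)) (hind : iIndepFun Y μ) (hB : ∀ i ω, |Y i ω| ≤ B)
    (hV : ∑ i, w i ^ 2 ≤ V) (hs : 0 ≤ s) (hB0 : 0 ≤ B) :
    μ.real {ω | s ≤ |∑ i, w i * (Y i ω - ∫ ω', Y i ω' ∂μ)|} ≤
      2 * Real.exp (-s ^ 2 / (2 * (B ^ 2 * V))) := by
  have hV0 : 0 ≤ V := (Finset.sum_nonneg fun i _ => sq_nonneg (w i)).trans hV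
  set Z : ι → Ω → ℝ := fun i ω => w i * (Y i ω - ∫ ω', Y i ω' ∂μ) with hZ
  have hindZ : iIndepFun Z μ :=
    hind.comp (fun i x => w i * (x - ∫ ω', Y i ω' ∂μ)) fun i => by fun_prop
  have hsub : ∀ i, HasSubgaussianMGF (Z i) (Real.toNNReal (w i ^ 2 * B ^ 2)) μ := by
    intro i
    -- The symmetric interval allows either sign of `w i`; half its length, squared, is the
    -- parameter `w i ^ 2 * B ^ 2`.
    have h1 := hasSubgaussianMGF_of_mem_Icc (μ := μ) (X := fun ω => w i * Y i ω)
      (a := -(|w i| * B)) (b := |w i| * B) ((hY i).const_mul (w i)).aemeasurable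
      (Eventually.of_forall fun ω => by
        rw [Set.mem_Icc, ← abs_le, abs_mul]
        exact mul_le_mul_of_nonneg_left (hB i ω) (abs_nonneg _))
    rw [integral_const_mul] at h1
    have h2 : (fun ω => w i * Y i ω - w i * ∫ ω', Y i ω' ∂μ) = Z i := by
      funext ω; simp only [hZ]; ring
    rw [h2] at h1
    refine hasSubgaussianMGF_mono h1 ?_
    rw [← NNReal.coe_le_coe, Real.coe_toNNReal _ (by positivity)]
    push_cast
    rw [Real.norm_eq_abs, sub_neg_eq_add, ← two_mul, abs_of_nonneg (by positivity),
      mul_div_cancel_left₀ _ two_ne_zero, mul_pow, sq_abs]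
  have hsum := HasSubgaussianMGF.sum_of_iIndepFun hindZ (s := Finset.univ)
    (fun i _ => hsub i)
  have hle : ∑ i, Real.toNNReal (w i ^ 2 * B ^ 2) ≤ Real.toNNReal (B ^ 2 * V) := by
    rw [← NNReal.coe_le_coe, Real.coe_toNNReal _ (by positivity)]
    push_cast
    calc ∑ i, ((Real.toNNReal (w i ^ 2 * B ^ 2) : ℝ≥0) : ℝ) = ∑ i, w i ^ 2 * B ^ 2 :=
          Finset.sum_congr rfl fun i _ => Real.coe_toNNReal _ (by positivity)
      _ = B ^ 2 * ∑ i, w i ^ 2 := by rw [← Finset.sum_mul, mul_comm]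
      _ ≤ B ^ 2 * V := by gcongr
  have hS := hasSubgaussianMGF_mono hsum hle
  have hup := hS.measure_ge_le hs
  have hlo := hS.neg.measure_ge_le hs
  rw [Real.coe_toNNReal _ (by positivity)] at hup hlo
  rw [two_mul]
  refine le_trans (le_trans (measureReal_mono ?_) (measureReal_union_le _ _))
    (add_le_add hup hlo)
  intro ω hω
  simp only [Set.mem_ofPred_eq, Set.mem_union, Pi.neg_apply] at hω ⊢
  exact le_abs.1 hω

/-- Cutting a square integrable variable off on a small event changes its mean by little. -/
lemma abs_integral_sub_indicator_le [IsProbabilityMeasure μ] {Y : Ω → ℝ} {A : Set Ω}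
    {m θ p : ℝ} (hA : MeasurableSet A) (hY : MemLp Y 2 μ) (hm : ∫ ω, Y ω ^ 2 ∂μ ≤ m)
    (hp : μ.real Aᶜ ≤ p) (hθ : 0 < θ) :
    |∫ ω, Y ω ∂μ - ∫ ω, A.indicator Y ω ∂μ| ≤ (θ * m + p / θ) / 2 := by
  have hYi : Integrable Y μ := hY.integrable one_le_two
  have hY2 : Integrable (fun ω => Y ω ^ 2) μ := hY.integrable_sq
  rw [← integral_sub hYi (hYi.indicator hA)]
  have hone : Integrable (Aᶜ.indicator fun _ => (1 : ℝ)) μ :=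
    (integrable_const _).indicator hA.compl
  refine (abs_integral_le_integral_abs).trans ?_
  calc ∫ ω, |Y ω - A.indicator Y ω| ∂μ
      ≤ ∫ ω, (θ * Y ω ^ 2 + Aᶜ.indicator (fun _ => (1 : ℝ)) ω / θ) / 2 ∂μ := by
        refine integral_mono (hYi.sub (hYi.indicator hA)).abs
          (((hY2.const_mul θ).add (hone.div_const θ)).div_const 2) fun ω => ?_
        by_cases hω : ω ∈ A
        · simp only [Set.indicator_of_mem hω, sub_self, abs_zero]
          have : ω ∉ Aᶜ := fun h => h hω
          simp only [Set.indicator_of_notMem this]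
          positivity
        · have : ω ∈ Aᶜ := hω
          simp only [Set.indicator_of_notMem hω, Set.indicator_of_mem this, sub_zero]
          -- AM–GM in place of Cauchy–Schwarz: |Y| ≤ (θY² + 1/θ)/2, with θ left free to be balanced
          -- later.
          have h1 : 0 ≤ (θ * |Y ω| - 1) ^ 2 / θ := by positivity
          have h2 : (θ * |Y ω| - 1) ^ 2 / θ = θ * Y ω ^ 2 - 2 * |Y ω| + 1 / θ := by
            rw [← sq_abs (Y ω)]; field_simp; ring
          linarith
    _ = (θ * ∫ ω, Y ω ^ 2 ∂μ + μ.real Aᶜ / θ) / 2 := by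
        have h1 : ∫ ω, Aᶜ.indicator (fun _ => (1 : ℝ)) ω ∂μ = μ.real Aᶜ :=
          integral_indicator_one hA.compl
        rw [integral_div, integral_add (hY2.const_mul θ) (hone.div_const θ), integral_const_mul,
          integral_div, h1]
    _ ≤ (θ * m + p / θ) / 2 := by gcongr

/-- Concentration of `∑ w_i g(Z_i)` on the event that no `|Z_i|` exceeds `L`. -/
lemma truncated_concentration [Fintype ι] [IsProbabilityMeasure μ] {Z : ι → Ω → ℝ}
    {g : ℝ → ℝ} {w : ι → ℝ} {L B V s m θ p W : ℝ} (hZ : ∀ i, Measurable (Z i))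
    (hind : iIndepFun Z μ) (hg : Measurable g) (hgB : ∀ z, |z| ≤ L → |g z| ≤ B)
    (hL2 : ∀ i, MemLp (fun ω => g (Z i ω)) 2 μ) (hm : ∀ i, ∫ ω, g (Z i ω) ^ 2 ∂μ ≤ m)
    (hp : μ.real {ω | ∀ i, |Z i ω| ≤ L}ᶜ ≤ p) (hθ : 0 < θ)
    (hV : ∑ i, w i ^ 2 ≤ V) (hW : ∑ i, |w i| ≤ W) (hs : 0 ≤ s) (hB : 0 ≤ B) (hm0 : 0 ≤ m)
    (hp0 : 0 ≤ p) :
    μ.real {ω | (∀ i, |Z i ω| ≤ L) ∧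
      s + W * ((θ * m + p / θ) / 2) < |∑ i, w i * (g (Z i ω) - ∫ ω', g (Z i ω') ∂μ)|} ≤
      2 * Real.exp (-s ^ 2 / (2 * (B ^ 2 * V))) := by
  set τ : ℝ := (θ * m + p / θ) / 2 with hτ
  have hτ0 : 0 ≤ τ := by positivity
  set T : Set ℝ := {z | |z| ≤ L} with hT
  have hTm : MeasurableSet T := measurableSet_le (by fun_prop) measurable_const
  have hcut : Measurable (T.indicator g) := hg.indicator hTm
  set Y : ι → Ω → ℝ := fun i ω => T.indicator g (Z i ω) with hYdef
  have hYB : ∀ i ω, |Y i ω| ≤ B := by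
    intro i ω
    by_cases h : Z i ω ∈ T
    · simpa [hYdef, Set.indicator_of_mem h] using hgB _ h
    · simpa [hYdef, Set.indicator_of_notMem h] using hB
  have hmain := hoeffding_weighted (μ := μ) (Y := Y) (w := w) (s := s)
    (fun i => hcut.comp (hZ i)) (hind.comp (fun _ => T.indicator g) fun _ => hcut) hYB hV hs hB
  have hbias : ∀ i, |∫ ω, g (Z i ω) ∂μ - ∫ ω, Y i ω ∂μ| ≤ τ := by
    intro i
    refine abs_integral_sub_indicator_le (A := Z i ⁻¹' T) (hZ i hTm) (hL2 i) (hm i)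
      (le_trans (measureReal_mono ?_) hp) hθ
    intro ω hω h
    exact hω (h i)
  refine (measureReal_mono ?_).trans hmain
  rintro ω ⟨hω, hlt⟩
  -- On the good event truncation changes no value, only the centring constants; these cost at most
  -- `W * τ`.
  have heq : ∑ i, w i * (g (Z i ω) - ∫ ω', g (Z i ω') ∂μ) =
      ∑ i, w i * (Y i ω - ∫ ω', Y i ω' ∂μ) -
        ∑ i, w i * (∫ ω', g (Z i ω') ∂μ - ∫ ω', Y i ω' ∂μ) := by
    rw [← Finset.sum_sub_distrib]
    refine Finset.sum_congr rfl fun i _ => ?_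
    have : Y i ω = g (Z i ω) := Set.indicator_of_mem (s := T) (hω i) g
    rw [this]; ring
  have hb : |∑ i, w i * (∫ ω', g (Z i ω') ∂μ - ∫ ω', Y i ω' ∂μ)| ≤ W * τ := by
    refine (Finset.abs_sum_le_sum_abs _ _).trans ?_
    calc ∑ i, |w i * (∫ ω', g (Z i ω') ∂μ - ∫ ω', Y i ω' ∂μ)| ≤ ∑ i, |w i| * τ :=
          Finset.sum_le_sum fun i _ => by
            rw [abs_mul]; exact mul_le_mul_of_nonneg_left (hbias i) (abs_nonneg _)
      _ = (∑ i, |w i|) * τ := by rw [Finset.sum_mul]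
      _ ≤ W * τ := by gcongr
  rw [heq] at hlt
  have := hlt.trans_le (abs_sub _ _)
  simp only [Set.mem_ofPred_eq]
  linarith

end Concentration

/-! ### Bias of moving averages and the pathwise error bound. -/

section Deterministic

/-- The increments of a function of bounded variation are dominated by those of a monotone
function. -/
lemma exists_monotone_dominating {α : ℝ → ℝ} {s : Set ℝ} (hα : BoundedVariationOn α s) :
    ∃ v : ℝ → ℝ, MonotoneOn v s ∧ ∀ x ∈ s, ∀ y ∈ s, x ≤ y → |α y - α x| ≤ v y - v x := by
  obtain ⟨p, q, hp, hq, rfl⟩ := hα.locallyBoundedVariationOn.exists_monotoneOn_sub_monotoneOn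
  refine ⟨p + q, hp.add hq, fun x hx y hy hxy => ?_⟩
  have h1 := hp hx hy hxy
  have h2 := hq hx hy hxy
  simp only [Pi.sub_apply, Pi.add_apply]
  rw [abs_le]
  constructor <;> linarith

/-- A shift by `k` is `k` unit shifts, and the sum for each unit shift telescopes to one increment
of `f`. Hence the window biases have a total independent of the number of windows. -/
lemma sum_shift_sub_le {f : ℕ → ℝ} {V : ℝ} (hV : ∀ i j, f j - f i ≤ V) (m k : ℕ) :
    ∑ t ∈ Finset.range m, (f (t + k) - f t) ≤ k * V := by
  induction k with
  | zero => simp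
  | succ k ih =>
    have h1 : ∑ t ∈ Finset.range m, (f (t + (k + 1)) - f t) =
        ∑ t ∈ Finset.range m, (f (t + 1 + k) - f (t + k)) +
          ∑ t ∈ Finset.range m, (f (t + k) - f t) := by
      rw [← Finset.sum_add_distrib]
      refine Finset.sum_congr rfl fun t _ => ?_
      rw [show t + (k + 1) = t + 1 + k by ring]; ring
    rw [h1, Finset.sum_range_sub (fun t => f (t + k))]
    have := hV (0 + k) (m + k)
    push_cast
    linarith

lemma prelim_sub (M : ℕ) (pad : ℤ → ℕ) (x y : ℕ → ℝ) (t : ℕ) :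
    prelim M pad (fun q => x q - y q) t = prelim M pad x t - prelim M pad y t := by
  simp only [prelim, Finset.sum_sub_distrib, sub_div]

/-- A moving average stays as close to a number as the averaged values. -/
lemma abs_prelim_sub_le {M : ℕ} {pad : ℤ → ℕ} {x : ℕ → ℝ} {t : ℕ} {c R : ℝ}
    (h : ∀ p ∈ Finset.Icc ((t : ℤ) - M) ((t : ℤ) + M), |x (pad p) - c| ≤ R) :
    |prelim M pad x t - c| ≤ R := by
  have hcard : ((Finset.Icc ((t : ℤ) - M) ((t : ℤ) + M)).card : ℝ) = 2 * M + 1 := by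
    have : (Finset.Icc ((t : ℤ) - M) ((t : ℤ) + M)).card = 2 * M + 1 := by
      rw [Int.card_Icc]; omega
    rw [this]; push_cast; ring
  have hpos : (0 : ℝ) < 2 * M + 1 := by positivity
  have h1 : prelim M pad x t - c =
      (∑ p ∈ Finset.Icc ((t : ℤ) - M) ((t : ℤ) + M), (x (pad p) - c)) / (2 * (M : ℝ) + 1) := by
    rw [Finset.sum_sub_distrib, Finset.sum_const, nsmul_eq_mul, hcard, sub_div,
      mul_div_cancel_left₀ _ hpos.ne']
    rfl
  rw [h1, abs_div, abs_of_pos hpos, div_le_iff₀ hpos]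
  calc _ ≤ ∑ p ∈ Finset.Icc ((t : ℤ) - M) ((t : ℤ) + M), |x (pad p) - c| :=
        Finset.abs_sum_le_sum_abs _ _
    _ ≤ ∑ _p ∈ Finset.Icc ((t : ℤ) - M) ((t : ℤ) + M), R := Finset.sum_le_sum h
    _ = R * (2 * M + 1) := by rw [Finset.sum_const, nsmul_eq_mul, hcard, mul_comm]

/-- The uniform weights of the moving average of half-width `M` around `t`. -/
noncomputable def windowWeight (M t q : ℕ) : ℝ :=
  if t ≤ q + M ∧ q ≤ t + M then 1 / (2 * (M : ℝ) + 1) else 0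

lemma window_card {n M t : ℕ} (h1 : M + 1 ≤ t) (h2 : t + M ≤ n) :
    ((Finset.Icc 1 n).filter fun q => t ≤ q + M ∧ q ≤ t + M).card = 2 * M + 1 := by
  have : (Finset.Icc 1 n).filter (fun q => t ≤ q + M ∧ q ≤ t + M) =
      Finset.Icc (t - M) (t + M) := by
    ext q; simp only [Finset.mem_filter, Finset.mem_Icc]; omega
  rw [this, Nat.card_Icc]; omega

lemma windowWeight_nonneg (M t q : ℕ) : 0 ≤ windowWeight M t q := by
  unfold windowWeight; split_ifs <;> positivity

lemma sum_windowWeight {n M t : ℕ} (h1 : M + 1 ≤ t) (h2 : t + M ≤ n) :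
    ∑ q ∈ Finset.Icc 1 n, windowWeight M t q = 1 := by
  have hpos : (0 : ℝ) < 2 * M + 1 := by positivity
  simp only [windowWeight, ← Finset.sum_filter]
  rw [Finset.sum_const, window_card h1 h2, nsmul_eq_mul]
  push_cast
  field_simp

lemma sum_windowWeight_sq {n M t : ℕ} (h1 : M + 1 ≤ t) (h2 : t + M ≤ n) :
    ∑ q ∈ Finset.Icc 1 n, windowWeight M t q ^ 2 = 1 / (2 * (M : ℝ) + 1) := by
  have hpos : (0 : ℝ) < 2 * M + 1 := by positivity
  have : ∀ q, windowWeight M t q ^ 2 = windowWeight M t q * (1 / (2 * (M : ℝ) + 1)) := by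
    intro q; unfold windowWeight; split_ifs <;> ring
  simp only [this]
  rw [← Finset.sum_mul, sum_windowWeight h1 h2, one_mul]

/-- Away from the boundary the moving average does not use the boundary rule. -/
lemma prelim_eq_localMean {n M t : ℕ} {pad : ℤ → ℕ} (hpad : IsBoundaryRule n pad)
    (h1 : M + 1 ≤ t) (h2 : t + M ≤ n) (x : ℕ → ℝ) :
    prelim M pad x t = localMean n (windowWeight M t) x := by
  have : localMean n (windowWeight M t) x =
      ∑ q ∈ (Finset.Icc 1 n).filter (fun q => t ≤ q + M ∧ q ≤ t + M),
        x q / (2 * (M : ℝ) + 1) := by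
    rw [Finset.sum_filter]
    refine Finset.sum_congr rfl fun q _ => ?_
    unfold windowWeight; split_ifs <;> ring
  rw [this, ← Finset.sum_div, prelim]
  congr 1
  -- The whole window lies in `1, …, n`, so `toNat` truncates nothing.
  refine Finset.sum_bij' (fun p _ => p.toNat) (fun q _ => (q : ℤ)) ?_ ?_ ?_ ?_ ?_
  · intro p hp
    simp only [Finset.mem_filter, Finset.mem_Icc] at hp ⊢; omega
  · intro q hq
    simp only [Finset.mem_filter, Finset.mem_Icc] at hq ⊢; omega
  · intro p hp
    simp only [Finset.mem_Icc] at hp ⊢; omega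
  · intro q hq
    simp
  · intro p hp
    simp only [Finset.mem_Icc] at hp
    obtain ⟨q, rfl⟩ : ∃ q : ℕ, p = q := ⟨p.toNat, by omega⟩
    rw [hpad.2 q (by omega) (by omega)]; simp

/-- The total bias and deviation of the moving averages: the interior points contribute the
deviation `A` and the variation `V`, the at most `2 M` boundary points contribute `R` each. -/
lemma sum_abs_prelim_sub_le {n M : ℕ} {d f : ℕ → ℝ} {A V R : ℝ} (hA : 0 ≤ A) (hR0 : 0 ≤ R)
    (hV : ∀ i j, f j - f i ≤ V)
    (hint : ∀ t, M + 1 ≤ t → t + M ≤ n → d t ≤ A + (f (t + M) - f (t - M)))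
    (hR : ∀ t ∈ Finset.Icc 1 n, d t ≤ R) :
    ∑ t ∈ Finset.Icc 1 n, d t ≤ n * A + 2 * M * V + 2 * M * R := by
  have hsub : Finset.Ico (M + 1) (n - M + 1) ⊆ Finset.Icc 1 n := by
    intro t; simp only [Finset.mem_Ico, Finset.mem_Icc]; omega
  rw [← Finset.sum_sdiff hsub]
  have hV0 : 0 ≤ V := by simpa using hV 0 0
  have hout : ∑ t ∈ Finset.Icc 1 n \ Finset.Ico (M + 1) (n - M + 1), d t ≤ 2 * M * R := by
    calc _ ≤ ∑ _t ∈ Finset.Icc 1 n \ Finset.Ico (M + 1) (n - M + 1), R :=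
          Finset.sum_le_sum fun t ht => hR t (Finset.sdiff_subset ht)
      _ = ((Finset.Icc 1 n \ Finset.Ico (M + 1) (n - M + 1)).card : ℝ) * R := by
          rw [Finset.sum_const, nsmul_eq_mul]
      _ ≤ 2 * M * R := by
          refine mul_le_mul_of_nonneg_right ?_ hR0
          have : (Finset.Icc 1 n \ Finset.Ico (M + 1) (n - M + 1)).card ≤ 2 * M := by
            rw [Finset.card_sdiff_of_subset hsub, Nat.card_Icc, Nat.card_Ico]; omega
          exact_mod_cast this
  have hin : ∑ t ∈ Finset.Ico (M + 1) (n - M + 1), d t ≤ n * A + 2 * M * V := by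
    calc _ ≤ ∑ t ∈ Finset.Ico (M + 1) (n - M + 1), (A + (f (t + M) - f (t - M))) := by
          refine Finset.sum_le_sum fun t ht => ?_
          rw [Finset.mem_Ico] at ht
          -- For `n < M` truncated subtraction makes the interior range empty.
          rcases le_or_gt M n with h | h
          · exact hint t (by omega) (by omega)
          · omega
      _ = ((Finset.Ico (M + 1) (n - M + 1)).card : ℝ) * A +
            ∑ t ∈ Finset.Ico (M + 1) (n - M + 1), (f (t + M) - f (t - M)) := by
          rw [Finset.sum_add_distrib, Finset.sum_const, nsmul_eq_mul]
      _ ≤ n * A + 2 * M * V := by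
          refine add_le_add (mul_le_mul_of_nonneg_right ?_ hA) ?_
          · rw [Nat.card_Ico]; exact_mod_cast (by omega)
          · rw [Finset.sum_Ico_eq_sum_range]
            -- With `t = M + 1 + i` the window ends are `i + 1` and `i + 1 + 2 * M`, a shift by `2 *
            -- M`.
            have := sum_shift_sub_le (f := fun i => f (i + 1)) (fun i j => hV _ _)
              (n - M + 1 - (M + 1)) (2 * M)
            rw [Nat.cast_mul, Nat.cast_two] at this
            refine le_trans (le_of_eq (Finset.sum_congr rfl fun i _ => ?_)) this
            congr 2 <;> omega
  linarith

lemma kernelWeight_nonneg {K : ℝ → ℝ} (hK : ∀ z, 0 ≤ K z) (n : ℕ) {b : ℝ} (hb : 0 < b)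
    (a u : ℝ) : 0 ≤ kernelWeight K n b a u :=
  mul_nonneg (by positivity) (hK _)

lemma kernelWeight_le {K : ℝ → ℝ} {C : ℝ} (hK : ∀ z, K z ≤ C) (n : ℕ) {b : ℝ} (hb : 0 < b)
    (a u : ℝ) : kernelWeight K n b a u ≤ C / (n * b) := by
  rw [kernelWeight, one_div_mul_eq_div]
  gcongr
  exact hK _

/-- One factor 1/b is the normalisation, the other the Lipschitz constant of K(·/b). This b⁻² is the
source of the conditions ζ < ϑ/4 and ζ < ε/4. -/
lemma abs_kernelWeight_sub_le {K : ℝ → ℝ} {Lk : ℝ≥0} (hK : LipschitzWith Lk K) {n : ℕ}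
    {b : ℝ} (hb : 0 < b) (a u a' u' : ℝ) :
    |kernelWeight K n b a u - kernelWeight K n b a' u'| ≤
      Lk / (n * b ^ 2) * (|a - a'| + |u - u'|) := by
  have h1 := hK.dist_le_mul ((a - u) / b) ((a' - u') / b)
  rw [Real.dist_eq, Real.dist_eq, ← sub_div, abs_div, abs_of_pos hb] at h1
  have h2 : |a - u - (a' - u')| ≤ |a - a'| + |u - u'| := by
    rw [show a - u - (a' - u') = (a - a') - (u - u') by ring]; exact abs_sub _ _
  rw [kernelWeight, kernelWeight, ← mul_sub, abs_mul, abs_of_nonneg (by positivity)]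
  calc _ ≤ 1 / (n * b) * (Lk * ((|a - a'| + |u - u'|) / b)) := by
        refine mul_le_mul_of_nonneg_left (h1.trans ?_) (by positivity)
        gcongr
    _ = _ := by rw [sq]; ring

/-- The error of the variance function estimator in terms of the total deviation `S` of the
preliminary estimator, the deviation `ρ` of the local mean, and the deviation `T` of the
smoothed squared noise. -/
lemma abs_hHat_sub_le {K h : ℝ → ℝ} {n M : ℕ} {b : ℝ} {pad : ℤ → ℕ} {x a : ℕ → ℝ} {Lk : ℝ≥0}
    {u u' Ck L R S ρ T hm H c₁ E : ℝ} (hn : 0 < n) (hb : 0 < b) (hb1 : b ≤ 1)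
    (hK0 : ∀ z, 0 ≤ K z) (hKC : ∀ z, K z ≤ Ck) (hKL : LipschitzWith Lk K)
    (hKs : ∀ z, z ∉ Set.Icc (-(1 / 2) : ℝ) (1 / 2) → K z = 0)
    (hL : ∀ t ∈ Finset.Icc 1 n, |x t - a t| ≤ L)
    (hR : ∀ t ∈ Finset.Icc 1 n, |prelim M pad x t - a t| ≤ R)
    (hS : ∑ t ∈ Finset.Icc 1 n, |prelim M pad x t - a t| ≤ S) (hρ : |u' - u| ≤ ρ)
    (hT : |∑ t ∈ Finset.Icc 1 n, kernelWeight K n b (a t) u * ((x t - a t) ^ 2 - h (a t))| ≤ T)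
    (hu : |h u| ≤ hm) (hH : 0 ≤ H) (hlip : ∀ t ∈ Finset.Icc 1 n, |h (a t) - h u| ≤ H * |a t - u|)
    (hc₁ : 0 < c₁) (hD : c₁ ≤ ∑ t ∈ Finset.Icc 1 n, kernelWeight K n b (a t) u)
    (hE : (S + n * ρ) / (n * b ^ 2) ≤ E) (hEc : Lk * E ≤ c₁ / 2) :
    |hHat K n M b pad x u' - h u| ≤
      2 / c₁ * ((Ck * (2 * L + R) + (L ^ 2 + hm) * Lk) * E + T) + 2 * H * b := by
  have hn' : (0 : ℝ) < n := by exact_mod_cast hn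
  set s := Finset.Icc 1 n with hs
  set c : ℕ → ℝ := prelim M pad x with hc
  set W : ℕ → ℝ := fun t => kernelWeight K n b (a t) u with hW
  set Wh : ℕ → ℝ := fun t => kernelWeight K n b (c t) u' with hWh
  have hmem : (1 : ℕ) ∈ s := by rw [hs, Finset.mem_Icc]; omega
  have hL0 : 0 ≤ L := (abs_nonneg _).trans (hL 1 hmem)
  have hR0 : 0 ≤ R := (abs_nonneg _).trans (hR 1 hmem)
  have hCk0 : 0 ≤ Ck := (hK0 0).trans (hKC 0)
  have hS0 : 0 ≤ S := (Finset.sum_nonneg fun _ _ => abs_nonneg _).trans hS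
  have hρ0 : 0 ≤ ρ := (abs_nonneg _).trans hρ
  have hhm0 : 0 ≤ hm := (abs_nonneg _).trans hu
  have hE0 : 0 ≤ E := le_trans (by positivity) hE
  have hW0 : ∀ t, 0 ≤ W t := fun t => kernelWeight_nonneg hK0 n hb _ _
  have hWh0 : ∀ t, 0 ≤ Wh t := fun t => kernelWeight_nonneg hK0 n hb _ _
  set D := ∑ t ∈ s, W t with hDdef
  set Dh := ∑ t ∈ s, Wh t with hDh
  have hdiff : ∑ t ∈ s, |Wh t - W t| ≤ Lk * E := by
    calc _ ≤ ∑ t ∈ s, Lk / (n * b ^ 2) * (|c t - a t| + ρ) := by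
          refine Finset.sum_le_sum fun t _ => (abs_kernelWeight_sub_le hKL hb _ _ _ _).trans ?_
          gcongr
      _ = Lk / (n * b ^ 2) * (∑ t ∈ s, |c t - a t| + n * ρ) := by
          rw [← Finset.mul_sum, Finset.sum_add_distrib, Finset.sum_const, nsmul_eq_mul, hs,
            Nat.card_Icc, Nat.add_sub_cancel]
      _ ≤ Lk / (n * b ^ 2) * (S + n * ρ) := by gcongr
      _ = Lk * ((S + n * ρ) / (n * b ^ 2)) := by ring
      _ ≤ Lk * E := by gcongr
  have hDD : D / 2 ≤ Dh := by
    have h1 : |Dh - D| ≤ Lk * E := by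
      rw [hDh, hDdef, ← Finset.sum_sub_distrib]
      exact (Finset.abs_sum_le_sum_abs _ _).trans hdiff
    have := (abs_le.1 h1).1
    linarith
  have hDpos : 0 < D := hc₁.trans_le hD
  have hDh0 : 0 < Dh := by linarith
  -- Four sources of error: estimated residuals, estimated weights, fluctuation of the squared
  -- noise, and the smoothing bias of `h`.
  have hnum : hHat K n M b pad x u' - h u =
      (∑ t ∈ s, Wh t * ((x t - c t) ^ 2 - (x t - a t) ^ 2) +
        ∑ t ∈ s, (Wh t - W t) * ((x t - a t) ^ 2 - h u) +
        ∑ t ∈ s, W t * ((x t - a t) ^ 2 - h (a t)) + ∑ t ∈ s, W t * (h (a t) - h u)) / Dh := by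
    have : hHat K n M b pad x u' = (∑ t ∈ s, Wh t * (x t - c t) ^ 2) / Dh := rfl
    rw [this, eq_div_iff hDh0.ne', sub_mul, div_mul_cancel₀ _ hDh0.ne', hDh, Finset.mul_sum,
      ← Finset.sum_sub_distrib, ← Finset.sum_add_distrib, ← Finset.sum_add_distrib,
      ← Finset.sum_add_distrib]
    refine Finset.sum_congr rfl fun t _ => ?_
    ring
  have hI : |∑ t ∈ s, Wh t * ((x t - c t) ^ 2 - (x t - a t) ^ 2)| ≤ Ck * (2 * L + R) * E := by
    calc _ ≤ ∑ t ∈ s, |Wh t * ((x t - c t) ^ 2 - (x t - a t) ^ 2)| :=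
          Finset.abs_sum_le_sum_abs _ _
      _ ≤ ∑ t ∈ s, Ck / (n * b) * ((2 * L + R) * |c t - a t|) := by
          refine Finset.sum_le_sum fun t ht => ?_
          rw [abs_mul, abs_of_nonneg (hWh0 t),
            show (x t - c t) ^ 2 - (x t - a t) ^ 2 =
              ((c t - a t) - 2 * (x t - a t)) * (c t - a t) by ring, abs_mul]
          refine mul_le_mul (kernelWeight_le hKC n hb _ _)
            (mul_le_mul_of_nonneg_right ?_ (abs_nonneg _)) (by positivity) (by positivity)
          refine (abs_sub _ _).trans ?_
          rw [abs_mul, abs_two]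
          linarith [hL t ht, hR t ht]
      _ = Ck * (2 * L + R) * ((∑ t ∈ s, |c t - a t|) / (n * b)) := by
          rw [← Finset.mul_sum, ← Finset.mul_sum]; ring
      _ ≤ Ck * (2 * L + R) * E := by
          refine mul_le_mul_of_nonneg_left (le_trans ?_ hE) (by positivity)
          -- Here `b ≤ 1` gives `n * b ^ 2 ≤ n * b`.
          refine div_le_div₀ (by positivity) ?_ (by positivity) ?_
          · nlinarith [mul_nonneg hn'.le hρ0]
          · refine mul_le_mul_of_nonneg_left ?_ hn'.le
            nlinarith
  have hII : |∑ t ∈ s, (Wh t - W t) * ((x t - a t) ^ 2 - h u)| ≤ (L ^ 2 + hm) * Lk * E := by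
    calc _ ≤ ∑ t ∈ s, |(Wh t - W t) * ((x t - a t) ^ 2 - h u)| := Finset.abs_sum_le_sum_abs _ _
      _ ≤ ∑ t ∈ s, |Wh t - W t| * (L ^ 2 + hm) := by
          refine Finset.sum_le_sum fun t ht => ?_
          rw [abs_mul]
          refine mul_le_mul_of_nonneg_left ((abs_sub _ _).trans (add_le_add ?_ hu))
            (abs_nonneg _)
          rw [abs_of_nonneg (sq_nonneg _), ← sq_abs]
          exact pow_le_pow_left₀ (abs_nonneg _) (hL t ht) 2
      _ = (∑ t ∈ s, |Wh t - W t|) * (L ^ 2 + hm) := by rw [Finset.sum_mul]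
      _ ≤ Lk * E * (L ^ 2 + hm) := by gcongr
      _ = _ := by ring
  have hIV : |∑ t ∈ s, W t * (h (a t) - h u)| ≤ H * b * D := by
    calc _ ≤ ∑ t ∈ s, |W t * (h (a t) - h u)| := Finset.abs_sum_le_sum_abs _ _
      _ ≤ ∑ t ∈ s, H * b * W t := by
          refine Finset.sum_le_sum fun t ht => ?_
          rw [abs_mul, abs_of_nonneg (hW0 t), mul_comm]
          -- Only `t` with `|a t - u| ≤ b / 2` carry weight, so the Lipschitz bound on `h` gives
          -- order `b`.
          by_cases hz : (a t - u) / b ∈ Set.Icc (-(1 / 2) : ℝ) (1 / 2)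
          · refine mul_le_mul_of_nonneg_right ((hlip t ht).trans ?_) (hW0 t)
            refine mul_le_mul_of_nonneg_left ?_ hH
            have h1 : |(a t - u) / b| ≤ 1 / 2 := abs_le.2 hz
            rw [abs_div, abs_of_pos hb, div_le_iff₀ hb] at h1
            linarith
          · have : W t = 0 := by simp only [hW, kernelWeight, hKs _ hz, mul_zero]
            rw [this]; simp
      _ = H * b * D := by rw [← Finset.mul_sum]
  rw [hnum, abs_div, abs_of_pos hDh0, div_le_iff₀ hDh0]
  set Q := (Ck * (2 * L + R) + (L ^ 2 + hm) * Lk) * E + T with hQ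
  have hQ0 : 0 ≤ Q := by
    have : 0 ≤ T := (abs_nonneg _).trans hT
    have := Lk.2
    positivity
  -- Division by `Dh` uses `c₁ / 2 ≤ D / 2 ≤ Dh`; the same inequality puts the factor 2 in the bias
  -- term.
  have h1 : Q ≤ 2 / c₁ * Q * Dh := by
    have : 1 ≤ 2 / c₁ * Dh := by
      rw [div_mul_eq_mul_div, le_div_iff₀ hc₁]; linarith
    nlinarith
  have h2 : H * b * D ≤ 2 * H * b * Dh := by
    have : 0 ≤ H * b := by positivity
    nlinarith
  refine le_trans (abs_add_le _ _) (le_trans (add_le_add (abs_add_le _ _) hIV) ?_)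
  have h3 := abs_add_le (∑ t ∈ s, Wh t * ((x t - c t) ^ 2 - (x t - a t) ^ 2))
    (∑ t ∈ s, (Wh t - W t) * ((x t - a t) ^ 2 - h u))
  have h4 : Q = Ck * (2 * L + R) * E + (L ^ 2 + hm) * Lk * E + T := by rw [hQ]; ring
  linarith

end Deterministic

/-! ### Calculus of polynomial orders in n = 2^J. -/

section PolynomialOrder

/-- `f J = O(n ^ e)` where `n = 2 ^ J`. -/
def IsPolyO (f : ℕ → ℝ) (e : ℝ) : Prop := f =O[atTop] fun J : ℕ => ((2 : ℝ) ^ J) ^ e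

lemma IsPolyO.mono {f : ℕ → ℝ} {e e' : ℝ} (hf : IsPolyO f e) (h : e ≤ e') : IsPolyO f e' :=
  hf.trans <| IsBigO.of_bound 1 <| Eventually.of_forall fun J => by
    rw [one_mul, Real.norm_of_nonneg (by positivity), Real.norm_of_nonneg (by positivity)]
    exact Real.rpow_le_rpow_of_exponent_le (one_le_pow₀ one_le_two) h

lemma IsPolyO.mul {f g : ℕ → ℝ} {e e' : ℝ} (hf : IsPolyO f e) (hg : IsPolyO g e') :
    IsPolyO (fun J => f J * g J) (e + e') :=
  (IsBigO.mul hf hg).congr_right fun J => (Real.rpow_add (by positivity) _ _).symm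

lemma IsPolyO.add {f g : ℕ → ℝ} {e : ℝ} (hf : IsPolyO f e) (hg : IsPolyO g e) :
    IsPolyO (fun J => f J + g J) e :=
  IsBigO.add hf hg

lemma IsPolyO.const_mul {f : ℕ → ℝ} {e : ℝ} (c : ℝ) (hf : IsPolyO f e) :
    IsPolyO (fun J => c * f J) e :=
  IsBigO.const_mul_left hf c

lemma isPolyO_const (c : ℝ) : IsPolyO (fun _ => c) 0 :=
  (isBigO_const_const c (one_ne_zero (α := ℝ)) atTop).congr_right fun J => by simp

lemma isPolyO_rpow (e : ℝ) : IsPolyO (fun J => ((2 : ℝ) ^ J) ^ e) e := isBigO_refl _ _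

lemma isPolyO_inv : IsPolyO (fun J => ((2 : ℝ) ^ J)⁻¹) (-1) :=
  (isPolyO_rpow (-1)).congr_left fun _ => Real.rpow_neg_one _

lemma IsPolyO.sqrt {f : ℕ → ℝ} {e : ℝ} (hf : IsPolyO f e) :
    IsPolyO (fun J => √(f J)) (e / 2) := by
  obtain ⟨c, hc, h⟩ := IsBigO.exists_pos hf
  refine IsBigO.of_bound (√c) (h.bound.mono fun J hJ => ?_)
  rw [Real.norm_of_nonneg (Real.rpow_nonneg (by positivity) _)] at hJ ⊢
  have h1 : ((2 : ℝ) ^ J) ^ (e / 2) = √(((2 : ℝ) ^ J) ^ e) := by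
    rw [Real.sqrt_eq_rpow, ← Real.rpow_mul (by positivity), mul_one_div]
  rw [Real.norm_of_nonneg (Real.sqrt_nonneg _), h1, ← Real.sqrt_mul hc.le]
  exact Real.sqrt_le_sqrt ((le_abs_self _).trans hJ)

lemma tendsto_two_pow : Tendsto (fun J : ℕ => (2 : ℝ) ^ J) atTop atTop :=
  tendsto_pow_atTop_atTop_of_one_lt one_lt_two

lemma isPolyO_log_rpow (r : ℝ) {η : ℝ} (hη : 0 < η) :
    IsPolyO (fun J => Real.log ((2 : ℝ) ^ J) ^ r) η :=
  ((isLittleO_log_rpow_rpow_atTop r hη).comp_tendsto tendsto_two_pow).isBigO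

lemma isPolyO_log {η : ℝ} (hη : 0 < η) : IsPolyO (fun J => Real.log ((2 : ℝ) ^ J)) η := by
  simpa using isPolyO_log_rpow 1 hη

lemma IsPolyO.tendsto_zero {f : ℕ → ℝ} {e : ℝ} (hf : IsPolyO f e) (he : e < 0) :
    Tendsto f atTop (nhds 0) := by
  refine IsBigO.trans_tendsto hf ?_
  have := (tendsto_rpow_neg_atTop (neg_pos.2 he)).comp tendsto_two_pow
  simpa [Function.comp_def] using this

/-- A sequence of negative polynomial order is eventually below every power of the logarithm. -/
lemma IsPolyO.eventually_lt_log {f : ℕ → ℝ} {e c : ℝ} (hf : IsPolyO f e) (he : e < 0)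
    (hc : 0 < c) (v : ℝ) : ∀ᶠ J : ℕ in atTop, f J < c * Real.log ((2 : ℝ) ^ J) ^ v := by
  -- Half of the polynomial decay pays for the factor log^(-v).
  have h1 := (hf.mul (isPolyO_log_rpow (-v) (η := -e / 2) (by linarith))).tendsto_zero
    (by linarith)
  filter_upwards [h1.eventually_lt_const hc, eventually_ge_atTop 1] with J hJ hJ1
  have hpos : 0 < Real.log ((2 : ℝ) ^ J) := Real.log_pos (one_lt_pow₀ one_lt_two (by omega))
  rwa [Real.rpow_neg hpos.le, ← div_eq_mul_inv, div_lt_iff₀ (Real.rpow_pos_of_pos hpos _)] at hJ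

end PolynomialOrder

/-! ### Concentration at a fixed sample size. -/

section Stage

variable {Ω : Type*} [MeasurableSpace Ω] {μ : Measure Ω}

/-- Concentration, with probability `1 - O(n⁻³)`, of a weighted sum over the sample. -/
lemma sample_concentration [IsProbabilityMeasure μ] {n : ℕ} {Z : ℕ → Ω → ℝ} {g : ℝ → ℝ}
    {w : ℕ → ℝ} {L B V m p W : ℝ} (hn : 0 < n)
    (hZ : ∀ t ∈ Finset.Icc 1 n, Measurable (Z t))
    (hind : iIndepFun (fun t : Finset.Icc 1 n => Z t) μ) (hg : Measurable g)
    (hgB : ∀ z, |z| ≤ L → |g z| ≤ B)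
    (hL2 : ∀ t ∈ Finset.Icc 1 n, MemLp (fun ω => g (Z t ω)) 2 μ)
    (hm : ∀ t ∈ Finset.Icc 1 n, ∫ ω, g (Z t ω) ^ 2 ∂μ ≤ m)
    (hp : μ.real {ω | ∀ t ∈ Finset.Icc 1 n, |Z t ω| ≤ L}ᶜ ≤ p * ((n : ℝ) ^ 2)⁻¹)
    (hw : ∀ t ∈ Finset.Icc 1 n, 0 ≤ w t) (hV : ∑ t ∈ Finset.Icc 1 n, w t ^ 2 ≤ V)
    (hW : ∑ t ∈ Finset.Icc 1 n, w t ≤ W) (hB : 0 < B) (hV0 : 0 < V) (hm0 : 0 ≤ m)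
    (hp0 : 0 ≤ p) :
    μ.real {ω | (∀ t ∈ Finset.Icc 1 n, |Z t ω| ≤ L) ∧
      B * √(6 * Real.log n * V) + W * ((m + p) / 2 * (n : ℝ)⁻¹) <
        |∑ t ∈ Finset.Icc 1 n, w t * (g (Z t ω) - ∫ ω', g (Z t ω') ∂μ)|} ≤
      2 * ((n : ℝ) ^ 3)⁻¹ := by
  have hn' : (0 : ℝ) < n := by exact_mod_cast hn
  have hlog : 0 ≤ Real.log n := Real.log_nonneg (by exact_mod_cast hn)
  have hset : ∀ ω, (∀ t ∈ Finset.Icc 1 n, |Z t ω| ≤ L) ↔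
      ∀ i : Finset.Icc 1 n, |Z i ω| ≤ L := fun ω =>
    ⟨fun h i => h i i.2, fun h t ht => h ⟨t, ht⟩⟩
  have hsum : ∀ F : ℕ → ℝ, ∑ t ∈ Finset.Icc 1 n, F t = ∑ i : Finset.Icc 1 n, F i := fun F =>
    (Finset.sum_coe_sort (Finset.Icc 1 n) F).symm
  -- The constant 6 makes the Hoeffding exponent -3 log n, which leaves a factor 1/n for a union
  -- bound over `t`. The choice θ = 1/n brings both halves of the truncation bias to order 1/n.
  have key := truncated_concentration (μ := μ) (Z := fun i : Finset.Icc 1 n => Z i) (g := g)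
    (w := fun i : Finset.Icc 1 n => w i) (L := L) (B := B) (V := V)
    (s := B * √(6 * Real.log n * V)) (m := m) (θ := (n : ℝ)⁻¹) (p := p * ((n : ℝ) ^ 2)⁻¹)
    (W := W) (fun i => hZ i i.2) hind hg hgB (fun i => hL2 i i.2) (fun i => hm i i.2)
    (by simpa only [hset] using hp) (by positivity) (by rw [← hsum fun t => w t ^ 2]; exact hV)
    (by
      have h1 : ∑ i : Finset.Icc 1 n, |w i| = ∑ i : Finset.Icc 1 n, w i :=
        Finset.sum_congr rfl fun i _ => abs_of_nonneg (hw i i.2)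
      rw [h1, ← hsum]; exact hW)
    (by positivity) hB.le hm0 (by positivity)
  have h1 : ((n : ℝ)⁻¹ * m + p * ((n : ℝ) ^ 2)⁻¹ / (n : ℝ)⁻¹) / 2 =
      (m + p) / 2 * (n : ℝ)⁻¹ := by
    field_simp
  have h2 : Real.exp (-(B * √(6 * Real.log n * V)) ^ 2 / (2 * (B ^ 2 * V))) =
      ((n : ℝ) ^ 3)⁻¹ := by
    have : -(B * √(6 * Real.log n * V)) ^ 2 / (2 * (B ^ 2 * V)) = -Real.log ((n : ℝ) ^ 3) := by
      rw [mul_pow, Real.sq_sqrt (by positivity), Real.log_pow]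
      field_simp
      push_cast
      ring
    rw [this, Real.exp_neg, Real.exp_log (by positivity)]
  rw [h1, h2] at key
  simp only [hset, fun ω => hsum fun t => w t * (g (Z t ω) - ∫ ω', g (Z t ω') ∂μ)]
  exact key

end Stage

/-! ### The exceptional event at a fixed sample size. -/

section Stage

variable {Ω : Type*} [MeasurableSpace Ω] {μ : Measure Ω}

/-- The error bound for the variance function estimator at one sample size `n`, on an event of
probability `1 - O(n⁻²)`. -/
lemma measure_hHat_error_le [IsProbabilityMeasure μ] {n M : ℕ} {X : ℕ → Ω → ℝ}
    {a f w : ℕ → ℝ} {pad : ℤ → ℕ} {K h : ℝ → ℝ} {Lk : ℝ≥0}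
    {b Ck L m p A₀ Vf V hm H c₁ A ρ T E : ℝ} (hn : 0 < n) (hpad : IsBoundaryRule n pad)
    (hX : ∀ t ∈ Finset.Icc 1 n, Measurable (X t))
    (hind : iIndepFun (fun t : Finset.Icc 1 n => X t) μ)
    (hmean : ∀ t ∈ Finset.Icc 1 n, ∫ ω, (X t ω - a t) ∂μ = 0)
    (hvar : ∀ t ∈ Finset.Icc 1 n, ∫ ω, (X t ω - a t) ^ 2 ∂μ = h (a t))
    (hL2 : ∀ t ∈ Finset.Icc 1 n, MemLp (fun ω => X t ω - a t) 2 μ)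
    (hL4 : ∀ t ∈ Finset.Icc 1 n, MemLp (fun ω => (X t ω - a t) ^ 2) 2 μ)
    (hm2 : ∀ t ∈ Finset.Icc 1 n, ∫ ω, (X t ω - a t) ^ 2 ∂μ ≤ m)
    (hm4 : ∀ t ∈ Finset.Icc 1 n, ∫ ω, ((X t ω - a t) ^ 2) ^ 2 ∂μ ≤ m)
    (hp : μ.real {ω | ∀ t ∈ Finset.Icc 1 n, |X t ω - a t| ≤ L}ᶜ ≤ p * ((n : ℝ) ^ 2)⁻¹)
    (hL : 0 < L) (hm0 : 0 ≤ m) (hp0 : 0 ≤ p)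
    (ha : ∀ t ∈ Finset.Icc 1 n, |a t| ≤ A₀)
    (hf : ∀ i j, f j - f i ≤ Vf) (hfm : Monotone f)
    (haf : ∀ i ∈ Finset.Icc 1 n, ∀ j ∈ Finset.Icc 1 n, i ≤ j → |a j - a i| ≤ f j - f i)
    (hw : ∀ t ∈ Finset.Icc 1 n, 0 ≤ w t) (hw1 : ∑ t ∈ Finset.Icc 1 n, w t = 1)
    (hwV : ∑ t ∈ Finset.Icc 1 n, w t ^ 2 ≤ V) (hV : 0 < V)
    (hb : 0 < b) (hb1 : b ≤ 1)
    (hK0 : ∀ z, 0 ≤ K z) (hKC : ∀ z, K z ≤ Ck) (hCk : 0 < Ck) (hKL : LipschitzWith Lk K)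
    (hKs : ∀ z, z ∉ Set.Icc (-(1 / 2) : ℝ) (1 / 2) → K z = 0)
    (hu : |h (localMean n w a)| ≤ hm) (hH : 0 ≤ H)
    (hlip : ∀ t ∈ Finset.Icc 1 n,
      |h (a t) - h (localMean n w a)| ≤ H * |a t - localMean n w a|)
    (hc₁ : 0 < c₁)
    (hD : c₁ ≤ ∑ t ∈ Finset.Icc 1 n, kernelWeight K n b (a t) (localMean n w a))
    (hA : A = L * √(6 * Real.log n * (1 / (2 * (M : ℝ) + 1))) + 1 * ((m + p) / 2 * (n : ℝ)⁻¹))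
    (hρ : ρ = L * √(6 * Real.log n * V) + 1 * ((m + p) / 2 * (n : ℝ)⁻¹))
    (hT : T = L ^ 2 * √(6 * Real.log n * (Ck ^ 2 / (n * b ^ 2))) +
      Ck / b * ((m + p) / 2 * (n : ℝ)⁻¹))
    (hE : E = (n * A + 2 * M * Vf + 2 * M * (L + 2 * A₀) + n * ρ) / (n * b ^ 2))
    (hEc : Lk * E ≤ c₁ / 2) :
    μ.real {ω | 2 / c₁ * ((Ck * (2 * L + (L + 2 * A₀)) + (L ^ 2 + hm) * Lk) * E + T) +
        2 * H * b < |hHat K n M b pad (fun t => X t ω) (localMean n w fun q => X q ω) -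
          h (localMean n w a)|} ≤ (p + 6) * ((n : ℝ) ^ 2)⁻¹ := by
  have hn' : (0 : ℝ) < n := by exact_mod_cast hn
  have hn1 : (1 : ℝ) ≤ n := by exact_mod_cast hn
  have hZm : ∀ t ∈ Finset.Icc 1 n, Measurable fun ω => X t ω - a t := fun t ht =>
    (hX t ht).sub_const _
  have hZi : iIndepFun (fun t : Finset.Icc 1 n => fun ω => X t ω - a t) μ :=
    hind.comp (fun t x => x - a t) fun t => by fun_prop
  -- Stated for general weights because it serves both the moving-average windows and the local
  -- mean.
  have hlin : ∀ w' : ℕ → ℝ, (∀ t ∈ Finset.Icc 1 n, 0 ≤ w' t) → ∑ t ∈ Finset.Icc 1 n, w' t = 1 →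
      ∀ V', 0 < V' → ∑ t ∈ Finset.Icc 1 n, w' t ^ 2 ≤ V' →
      μ.real {ω | (∀ t ∈ Finset.Icc 1 n, |X t ω - a t| ≤ L) ∧
        L * √(6 * Real.log n * V') + 1 * ((m + p) / 2 * (n : ℝ)⁻¹) <
          |localMean n w' fun t => X t ω - a t|} ≤ 2 * ((n : ℝ) ^ 3)⁻¹ := by
    intro w' hw0 hws V' hV' hwV'
    refine le_trans (measureReal_mono ?_) (sample_concentration (Z := fun t ω => X t ω - a t)
      (g := fun z => z) hn hZm hZi measurable_id (fun z hz => hz) hL2 hm2 hp hw0 hwV' hws.le hL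
      hV' hm0 hp0)
    rintro ω ⟨h1, h2⟩
    refine ⟨h1, h2.trans_eq ?_⟩
    congr 1
    refine Finset.sum_congr rfl fun t ht => ?_
    rw [hmean t ht, sub_zero]
  have hWnn : ∀ t ∈ Finset.Icc 1 n, 0 ≤ kernelWeight K n b (a t) (localMean n w a) :=
    fun t _ => kernelWeight_nonneg hK0 n hb _ _
  have hWle : ∀ t ∈ Finset.Icc 1 n,
      kernelWeight K n b (a t) (localMean n w a) ≤ Ck / (n * b) :=
    fun t _ => kernelWeight_le hKC n hb _ _
  have hsq : μ.real {ω | (∀ t ∈ Finset.Icc 1 n, |X t ω - a t| ≤ L) ∧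
      T < |∑ t ∈ Finset.Icc 1 n, kernelWeight K n b (a t) (localMean n w a) *
        ((X t ω - a t) ^ 2 - h (a t))|} ≤ 2 * ((n : ℝ) ^ 3)⁻¹ := by
    refine le_trans (measureReal_mono ?_) (sample_concentration (Z := fun t ω => X t ω - a t)
      (g := fun z => z ^ 2) (B := L ^ 2) (V := Ck ^ 2 / (n * b ^ 2)) (W := Ck / b) hn hZm hZi
      (by fun_prop) ?_ hL4 hm4 hp hWnn ?_ ?_ (by positivity) (by positivity) hm0 hp0)
    · rintro ω ⟨h1, h2⟩
      refine ⟨h1, (hT.symm.trans_lt h2).trans_eq ?_⟩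
      congr 1
      refine Finset.sum_congr rfl fun t ht => ?_
      rw [hvar t ht]
    · intro z hz
      rw [abs_of_nonneg (sq_nonneg z), ← sq_abs]
      exact pow_le_pow_left₀ (abs_nonneg _) hz 2
    · calc _ ≤ ∑ _t ∈ Finset.Icc 1 n, (Ck / (n * b)) ^ 2 :=
            Finset.sum_le_sum fun t ht => pow_le_pow_left₀ (hWnn t ht) (hWle t ht) 2
        _ = Ck ^ 2 / (n * b ^ 2) := by
            rw [Finset.sum_const, nsmul_eq_mul, Nat.card_Icc, Nat.add_sub_cancel]
            field_simp
    · calc _ ≤ ∑ _t ∈ Finset.Icc 1 n, Ck / (n * b) := Finset.sum_le_sum hWle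
        _ = Ck / b := by
            rw [Finset.sum_const, nsmul_eq_mul, Nat.card_Icc, Nat.add_sub_cancel]
            field_simp
  set G : Set Ω := {ω | ∀ t ∈ Finset.Icc 1 n, |X t ω - a t| ≤ L} with hG
  set I : Finset ℕ := (Finset.Icc 1 n).filter fun t => M + 1 ≤ t ∧ t + M ≤ n with hI
  set B₁ : ℕ → Set Ω := fun t => {ω | (∀ t ∈ Finset.Icc 1 n, |X t ω - a t| ≤ L) ∧
    A < |localMean n (windowWeight M t) fun t => X t ω - a t|} with hB₁
  set B₂ : Set Ω := {ω | (∀ t ∈ Finset.Icc 1 n, |X t ω - a t| ≤ L) ∧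
    ρ < |localMean n w fun t => X t ω - a t|} with hB₂
  set B₃ : Set Ω := {ω | (∀ t ∈ Finset.Icc 1 n, |X t ω - a t| ≤ L) ∧
      T < |∑ t ∈ Finset.Icc 1 n, kernelWeight K n b (a t) (localMean n w a) *
        ((X t ω - a t) ^ 2 - h (a t))|} with hB₃
  have hmB₁ : ∀ t ∈ I, μ.real (B₁ t) ≤ 2 * ((n : ℝ) ^ 3)⁻¹ := by
    intro t ht
    rw [hI, Finset.mem_filter] at ht
    have := hlin (windowWeight M t) (fun q _ => windowWeight_nonneg M t q)
      (sum_windowWeight ht.2.1 ht.2.2) (1 / (2 * (M : ℝ) + 1)) (by positivity)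
      (sum_windowWeight_sq ht.2.1 ht.2.2).le
    rwa [← hA] at this
  have hmB₂ : μ.real B₂ ≤ 2 * ((n : ℝ) ^ 3)⁻¹ := by
    have := hlin w hw hw1 V hV hwV
    rwa [← hρ] at this
  have hmU : μ.real (⋃ t ∈ I, B₁ t) ≤ 2 * ((n : ℝ) ^ 2)⁻¹ := by
    calc _ ≤ ∑ t ∈ I, μ.real (B₁ t) := measureReal_biUnion_finset_le _ _
      _ ≤ ∑ _t ∈ I, 2 * ((n : ℝ) ^ 3)⁻¹ := Finset.sum_le_sum hmB₁
      _ = (I.card : ℝ) * (2 * ((n : ℝ) ^ 3)⁻¹) := by rw [Finset.sum_const, nsmul_eq_mul]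
      _ ≤ n * (2 * ((n : ℝ) ^ 3)⁻¹) := by
          refine mul_le_mul_of_nonneg_right ?_ (by positivity)
          have : I.card ≤ n := (Finset.card_filter_le _ _).trans (by rw [Nat.card_Icc]; omega)
          exact_mod_cast this
      _ = 2 * ((n : ℝ) ^ 2)⁻¹ := by field_simp
  have h32 : 2 * ((n : ℝ) ^ 3)⁻¹ ≤ 2 * ((n : ℝ) ^ 2)⁻¹ := by
    have : (n : ℝ) ^ 2 ≤ (n : ℝ) ^ 3 := pow_le_pow_right₀ hn1 (by norm_num)
    gcongr
  -- The truncation event contributes `p`; the windows, the local mean and the squared noise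
  -- contribute 2 each.
  have htotal : μ.real (Gᶜ ∪ (⋃ t ∈ I, B₁ t) ∪ B₂ ∪ B₃) ≤ (p + 6) * ((n : ℝ) ^ 2)⁻¹ := by
    refine (measureReal_union_le _ _).trans ?_
    have h1 := measureReal_union_le (μ := μ) (Gᶜ ∪ (⋃ t ∈ I, B₁ t)) B₂
    have h2 := measureReal_union_le (μ := μ) Gᶜ (⋃ t ∈ I, B₁ t)
    linarith
  refine (measureReal_mono ?_).trans htotal
  intro ω hω
  by_contra hcon
  simp only [Set.mem_union, not_or] at hcon
  obtain ⟨⟨⟨hωG, hωU⟩, hω2⟩, hω3⟩ := hcon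
  have hωG : ∀ t ∈ Finset.Icc 1 n, |X t ω - a t| ≤ L := not_not.1 hωG
  have hω1 : ∀ t ∈ I, |localMean n (windowWeight M t) fun t => X t ω - a t| ≤ A := by
    intro t ht
    by_contra hlt
    exact hωU (Set.mem_biUnion ht ⟨hωG, not_le.1 hlt⟩)
  have hω2 : |localMean n w fun t => X t ω - a t| ≤ ρ := by
    by_contra hlt
    exact hω2 ⟨hωG, not_le.1 hlt⟩
  have hω3 : |∑ t ∈ Finset.Icc 1 n, kernelWeight K n b (a t) (localMean n w a) *
        ((X t ω - a t) ^ 2 - h (a t))| ≤ T := by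
    by_contra hlt
    exact hω3 ⟨hωG, not_le.1 hlt⟩
  have hA₀ : 0 ≤ A₀ := (abs_nonneg _).trans (ha 1 (Finset.mem_Icc.2 ⟨le_rfl, hn⟩))
  have hlog : 0 ≤ Real.log n := Real.log_nonneg hn1
  have hA0 : 0 ≤ A := by rw [hA]; positivity
  -- A crude bound, valid at the boundary too since the boundary rule returns sample indices; only
  -- about `2 * M` points rely on it in the sum.
  have hR : ∀ t ∈ Finset.Icc 1 n, |prelim M pad (fun t => X t ω) t - a t| ≤ L + 2 * A₀ := by
    intro t ht
    refine abs_prelim_sub_le fun q _ => ?_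
    have hq := Finset.mem_Icc.2 (hpad.1 q)
    rw [show X (pad q) ω - a t = (X (pad q) ω - a (pad q)) + (a (pad q) - a t) by ring]
    refine (abs_add_le _ _).trans (add_le_add (hωG _ hq) ((abs_sub _ _).trans ?_))
    linarith [ha _ hq, ha t ht]
  have hint : ∀ t, M + 1 ≤ t → t + M ≤ n →
      |prelim M pad (fun t => X t ω) t - a t| ≤ A + (f (t + M) - f (t - M)) := by
    intro t h1 h2
    have ht : t ∈ I := by rw [hI, Finset.mem_filter, Finset.mem_Icc]; omega
    have e1 : prelim M pad (fun t => X t ω) t - a t =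
        prelim M pad (fun t => X t ω - a t) t + (prelim M pad a t - a t) := by
      rw [prelim_sub]; ring
    rw [e1]
    refine (abs_add_le _ _).trans (add_le_add ?_ ?_)
    · rw [prelim_eq_localMean hpad h1 h2]
      exact hω1 t ht
    -- Bias: within the window the signal differs from `a t` by at most the increase of `f` across
    -- the window.
    · refine abs_prelim_sub_le fun q hq => ?_
      rw [Finset.mem_Icc] at hq
      obtain ⟨r, rfl⟩ : ∃ r : ℕ, q = r := ⟨q.toNat, by omega⟩
      rw [hpad.2 r (by omega) (by omega)]
      rcases le_total r t with hrt | hrt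
      · rw [abs_sub_comm]
        refine (haf r (Finset.mem_Icc.2 (by omega)) t (Finset.mem_Icc.2 (by omega)) hrt).trans ?_
        exact sub_le_sub (hfm (by omega)) (hfm (by omega))
      · refine (haf t (Finset.mem_Icc.2 (by omega)) r (Finset.mem_Icc.2 (by omega)) hrt).trans ?_
        exact sub_le_sub (hfm (by omega)) (hfm (by omega))
  have hS := sum_abs_prelim_sub_le (n := n) (M := M) hA0 (by positivity : 0 ≤ L + 2 * A₀) hf hint
    hR
  have hρ' : |(localMean n w fun q => X q ω) - localMean n w a| ≤ ρ := by
    refine le_trans (le_of_eq ?_) hω2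
    rw [localMean, localMean, localMean, ← Finset.sum_sub_distrib]
    simp only [mul_sub]
  exact absurd (abs_hHat_sub_le hn hb hb1 hK0 hKC hKL hKs hωG hR hS hρ' hω3 hu hH hlip hc₁ hD
    hE.ge hEc) (not_le.2 hω)

end Stage

/-! ### The signal on the grid and the scale restriction. -/

lemma signalRange_subset_hull {α : ℝ → ℝ} (h1 : SignalAssumption α) :
    signalRange α ⊆ signalHull α := fun _ hx =>
  ⟨csInf_le h1.bddBelow hx, le_csSup h1.bddAbove hx⟩

lemma gridPoint_mem {n t : ℕ} (ht : t ∈ Finset.Icc 1 n) :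
    (t : ℝ) / n ∈ Set.Icc (0 : ℝ) 1 := by
  rw [Finset.mem_Icc] at ht
  have hn : (0 : ℝ) < n := by exact_mod_cast ht.1.trans ht.2
  refine ⟨by positivity, ?_⟩
  rw [div_le_one hn]
  exact_mod_cast ht.2

/-- On the grid, the increments of the signal are dominated by those of a monotone sequence of
bounded total increase. -/
lemma exists_grid_modulus {α : ℝ → ℝ} (hα : BoundedVariationOn α (Set.Icc 0 1)) :
    ∃ V : ℝ, 0 ≤ V ∧ ∀ n : ℕ, ∃ f : ℕ → ℝ, (∀ i j, f j - f i ≤ V) ∧ Monotone f ∧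
      ∀ i ∈ Finset.Icc 1 n, ∀ j ∈ Finset.Icc 1 n, i ≤ j →
        |gridValues α n j - gridValues α n i| ≤ f j - f i := by
  obtain ⟨v, hv, hαv⟩ := exists_monotone_dominating hα
  have h0 : (0 : ℝ) ∈ Set.Icc (0 : ℝ) 1 := ⟨le_rfl, zero_le_one⟩
  have h1 : (1 : ℝ) ∈ Set.Icc (0 : ℝ) 1 := ⟨zero_le_one, le_rfl⟩
  -- Clamping the argument at 1 makes `f` monotone with bounded increase on all of ℕ, although `v`
  -- is controlled on [0, 1] only.
  refine ⟨v 1 - v 0, sub_nonneg.2 (hv h0 h1 zero_le_one), fun n =>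
    ⟨fun i => v (min ((i : ℝ) / n) 1), ?_, ?_, ?_⟩⟩
  · intro i j
    have hi : min ((i : ℝ) / n) 1 ∈ Set.Icc (0 : ℝ) 1 :=
      ⟨le_min (by positivity) zero_le_one, min_le_right _ _⟩
    have hj : min ((j : ℝ) / n) 1 ∈ Set.Icc (0 : ℝ) 1 :=
      ⟨le_min (by positivity) zero_le_one, min_le_right _ _⟩
    exact sub_le_sub (hv hj h1 hj.2) (hv h0 hi hi.1)
  · intro i j hij
    refine hv ⟨le_min (by positivity) zero_le_one, min_le_right _ _⟩
      ⟨le_min (by positivity) zero_le_one, min_le_right _ _⟩ (min_le_min_right _ ?_)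
    have : (i : ℝ) ≤ j := by exact_mod_cast hij
    gcongr
  · intro i hi j hj hij
    have hi' := gridPoint_mem hi
    have hj' := gridPoint_mem hj
    have : (i : ℝ) ≤ j := by exact_mod_cast hij
    simp only [min_eq_left hi'.2, min_eq_left hj'.2]
    exact hαv _ hi' _ hj' (by gcongr)

/-- Keeping the scales below (1 - ε)J gives the squared weights a sum of order n^(-ε), whence a
deviation of the local mean of order n^(-ε/2) up to logarithms, uniformly over the index set. -/
lemma scale_le_of_mem_indexSet {ε : ℝ} {J : ℕ} {p : ℕ × ℕ} (hp : p ∈ indexSet ε J) :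
    (2 : ℝ) ^ p.1 / 2 ^ J ≤ ((2 : ℝ) ^ J) ^ (-ε) := by
  have h := hp.2.2
  rw [← Real.rpow_natCast 2 p.1, ← Real.rpow_natCast 2 J, ← Real.rpow_sub two_pos,
    ← Real.rpow_mul two_pos.le]
  refine Real.rpow_le_rpow_of_exponent_le one_le_two ?_
  linarith

end WaveletFisz

/-! ### Rates and conclusion. -/

open WaveletFisz in
theorem corollary1 {Ω : ℕ → Type*} [∀ J, MeasurableSpace (Ω J)]
    (P : ∀ J, Measure (Ω J)) [∀ J, IsProbabilityMeasure (P J)]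
    (X : ∀ J, ℕ → Ω J → ℝ) (α h K : ℝ → ℝ)
    (M : ℕ → ℕ) (b δ : ℕ → ℝ) (pad : ℕ → ℤ → ℕ) (κ : ℕ → ℕ → ℕ → ℕ → ℝ)
    (ε ϑ ζ v : ℝ)
    (hmodel : WaveletFisz.IsRegressionModel P X α h)
    (hpad : ∀ J, WaveletFisz.IsBoundaryRule (2 ^ J) (pad J))
    (h1 : WaveletFisz.SignalAssumption α)
    (h2 : WaveletFisz.VarianceFunctionAssumption α h)
    (h3 : WaveletFisz.MomentAssumption P X α h)
    (h5 : WaveletFisz.WeightAssumption ε κ)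
    (h6 : WaveletFisz.KernelAssumption K)
    (h7 : WaveletFisz.SquaredNoiseAssumption P X α)
    (h8 : WaveletFisz.AbsoluteDeviationAssumption P X M pad)
    (h9 : WaveletFisz.TailAssumption P X α)
    (h10 : WaveletFisz.DesignAssumption α K b)
    (h11 : WaveletFisz.LocalMeanAssumption α ε κ)
    (hA : (ε, ϑ, ζ) ∈ WaveletFisz.admissible)
    (hM : (fun J => (M J : ℝ)) =Θ[atTop] fun J : ℕ => ((2 : ℝ) ^ J) ^ ϑ)
    (hb_pos : ∀ J, 0 < b J)
    (hb : b =Θ[atTop] fun J : ℕ => ((2 : ℝ) ^ J) ^ (-ζ))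
    (hv : v < 0)
    (hδ : ∃ c : ℝ, 0 < c ∧ ∀ᶠ J : ℕ in atTop, c * Real.log ((2 : ℝ) ^ J) ^ v ≤ δ J) :
    ∃ ς : ℝ, 0 < ς ∧ ∃ C : ℝ, ∀ᶠ J : ℕ in atTop, ∀ p ∈ WaveletFisz.indexSet ε J,
      (P J).real {ω | δ J ≤
          |WaveletFisz.hHat K (2 ^ J) (M J) (b J) (pad J) (fun t => X J t ω)
              (WaveletFisz.localMean (2 ^ J) (κ J p.1 p.2) (fun q => X J q ω)) -
            h (WaveletFisz.localMean (2 ^ J) (κ J p.1 p.2)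
              (WaveletFisz.gridValues α (2 ^ J)))|} ≤
        C * (((2 : ℝ) ^ J) ^ ϑ * Real.exp (-(((2 : ℝ) ^ J) ^ (2 * ς)) / 2) +
          (((2 : ℝ) ^ J) ^ 2)⁻¹) := by
  obtain ⟨⟨hε0, -⟩, hζ0, hζ⟩ := hA
  simp only [lt_min_iff] at hε0 hζ0 hζ
  obtain ⟨hζ1, hζ2, hζ3⟩ := hζ
  obtain ⟨Vf, hVf0, hmod⟩ := exists_grid_modulus h1.boundedVariation
  obtain ⟨hm, hhm⟩ := h2.bddAbove
  obtain ⟨H, hlip⟩ := h2.lipschitz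
  obtain ⟨Lk, hKL⟩ := h6.lipschitz
  obtain ⟨Ck', hCk'⟩ := h6.bounded
  obtain ⟨C₅, hC₅⟩ := h5.sum_sq
  obtain ⟨c₁, hc₁, hdesign⟩ := h10
  obtain ⟨c, hc, hδ⟩ := hδ
  obtain ⟨K₀, γ, hK₀, hγ, hmom⟩ := h3
  obtain ⟨a, d, ha, hd, htail⟩ := h9
  obtain ⟨p, hp0, hpO⟩ := htail.exists_nonneg
  have hsub := signalRange_subset_hull h1
  have hpos : ∀ u ∈ signalRange α, 0 < u := fun u hu => h1.inf_pos.trans_le (hsub hu).1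
  have hnn : ∀ u ∈ signalRange α, 0 ≤ h u := fun u hu => h2.nonneg u (hpos u hu).le
  have hle : ∀ u ∈ signalRange α, h u ≤ hm := fun u hu =>
    hhm (Set.mem_image_of_mem h (hsub hu))
  set A₀ : ℝ := sSup (signalRange α)
  have hgrid : ∀ n : ℕ, ∀ t ∈ Finset.Icc 1 n, gridValues α n t ∈ signalRange α :=
    fun n t ht => Set.mem_image_of_mem α (gridPoint_mem ht)
  have hhm0 : 0 ≤ hm := (hnn _ (hgrid 1 1 (by simp))).trans (hle _ (hgrid 1 1 (by simp)))
  set Ck : ℝ := max Ck' 1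
  have hCk : 0 < Ck := zero_lt_one.trans_le (le_max_right _ _)
  have hKC : ∀ z, K z ≤ Ck := fun z => (hCk' (Set.mem_range_self z)).trans (le_max_left _ _)
  -- The moment bound at l = 4 controls the second moment of the squared noise; `m` then serves for
  -- the noise and its square alike.
  set m₄ : ℝ := ((4).factorial : ℝ) ^ (1 + γ) * K₀ ^ (4 - 2) * hm
  have hm₄ : 0 ≤ m₄ := by positivity
  set m : ℝ := hm + m₄
  have hm0 : 0 ≤ m := by positivity
  -- the deterministic error terms and their polynomial orders
  obtain ⟨η, hη, g1, g2, g3, g4⟩ : ∃ η : ℝ, 0 < η ∧ 2 * ζ + 6 * η ≤ ϑ / 2 ∧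
      2 * ζ + ϑ + 5 * η ≤ 1 ∧ 2 * ζ + 6 * η ≤ ε / 2 ∧ 2 * η ≤ ζ := by
    -- A sixth of the smallest slack among moving-average noise, moving-average bias, local mean and
    -- smoothing bias. Each slack is positive by admissibility, and powers n^η absorb the
    -- logarithms.
    refine ⟨min (min (ϑ / 2 - 2 * ζ) (1 - ϑ - 2 * ζ)) (min (ε / 2 - 2 * ζ) ζ) / 6, ?_, ?_⟩
    · refine div_pos (lt_min (lt_min ?_ ?_) (lt_min ?_ ?_)) (by norm_num) <;> linarith
    · have e1 := min_le_left (min (ϑ / 2 - 2 * ζ) (1 - ϑ - 2 * ζ)) (min (ε / 2 - 2 * ζ) ζ)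
      have e2 := min_le_right (min (ϑ / 2 - 2 * ζ) (1 - ϑ - 2 * ζ)) (min (ε / 2 - 2 * ζ) ζ)
      have e3 := min_le_left (ϑ / 2 - 2 * ζ) (1 - ϑ - 2 * ζ)
      have e4 := min_le_right (ϑ / 2 - 2 * ζ) (1 - ϑ - 2 * ζ)
      have e5 := min_le_left (ε / 2 - 2 * ζ) ζ
      have e6 := min_le_right (ε / 2 - 2 * ζ) ζ
      refine ⟨?_, ?_, ?_, ?_⟩ <;> linarith
  set N : ℕ → ℝ := fun J => (2 : ℝ) ^ J with hN
  set L : ℕ → ℝ := fun J => a * Real.log (N J) ^ d with hLdef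
  set τ : ℕ → ℝ := fun J => (m + p) / 2 * (N J)⁻¹ with hτ
  set V : ℕ → ℝ := fun J => max C₅ 1 * N J ^ (-ε) with hVdef
  set A : ℕ → ℝ := fun J =>
    L J * √(6 * Real.log (N J) * (1 / (2 * (M J : ℝ) + 1))) + 1 * τ J with hAdef
  set ρ : ℕ → ℝ := fun J => L J * √(6 * Real.log (N J) * V J) + 1 * τ J with hρdef
  set T : ℕ → ℝ := fun J => L J ^ 2 * √(6 * Real.log (N J) * (Ck ^ 2 / (N J * b J ^ 2))) +
    Ck / b J * τ J with hTdef
  set E : ℕ → ℝ := fun J =>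
    (N J * A J + 2 * M J * Vf + 2 * M J * (L J + 2 * A₀) + N J * ρ J) / (N J * b J ^ 2) with hEdef
  set err : ℕ → ℝ := fun J => 2 / c₁ *
    ((Ck * (2 * L J + (L J + 2 * A₀)) + (L J ^ 2 + hm) * Lk) * E J + T J) + 2 * H * b J with herr
  have hNpos : ∀ J, 0 < N J := fun J => by positivity
  have oL : IsPolyO L η := (isPolyO_log_rpow d hη).const_mul a
  have oLc : IsPolyO (fun J => L J + 2 * A₀) η := oL.add ((isPolyO_const _).mono hη.le)
  have olog : IsPolyO (fun J => 6 * Real.log (N J)) η := (isPolyO_log hη).const_mul 6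
  have oτ : IsPolyO τ (-1) := isPolyO_inv.const_mul _
  have oV : IsPolyO V (-ε) := (isPolyO_rpow _).const_mul _
  have oM : IsPolyO (fun J => (M J : ℝ)) ϑ := hM.1
  have oMi : IsPolyO (fun J => 1 / (2 * (M J : ℝ) + 1)) (-ϑ) := by
    have e1 : (fun J => N J ^ ϑ) =O[atTop] fun J => 2 * (M J : ℝ) + 1 := by
      refine hM.2.trans (IsBigO.of_bound 1 (Eventually.of_forall fun J => ?_))
      rw [Real.norm_of_nonneg (by positivity), Real.norm_of_nonneg (by positivity)]
      have : (0 : ℝ) ≤ M J := by positivity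
      linarith
    refine (e1.inv_rev (Eventually.of_forall fun J hJ => ?_)).congr (fun J => ?_) fun J => ?_
    · exact absurd hJ (Real.rpow_pos_of_pos (hNpos J) _).ne'
    · exact (one_div _).symm
    · exact (Real.rpow_neg (hNpos J).le _).symm
  have obi : IsPolyO (fun J => (b J)⁻¹) ζ := by
    refine (hb.2.inv_rev (Eventually.of_forall fun J hJ => ?_)).congr_right fun J => ?_
    · exact absurd hJ (Real.rpow_pos_of_pos (hNpos J) _).ne'
    · rw [Real.rpow_neg (hNpos J).le, inv_inv]
  have ob : IsPolyO b (-ζ) := hb.1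
  have oτ1 : IsPolyO (fun J => 1 * τ J) (-1) := oτ.const_mul 1
  have oA : IsPolyO A (-2 * ζ - 4 * η) :=
    ((oL.mul (olog.mul oMi).sqrt).mono (by linarith)).add (oτ1.mono (by linarith))
  have oρ : IsPolyO ρ (-2 * ζ - 4 * η) :=
    ((oL.mul (olog.mul oV).sqrt).mono (by linarith)).add (oτ1.mono (by linarith))
  -- The final error multiplies `E` by a factor of order L², at most n^(2η), so n^(-2η) survives.
  have oE : IsPolyO E (-4 * η) := by
    have e1 : IsPolyO (fun J => (M J : ℝ) * (2 * Vf + 2 * (L J + 2 * A₀)) * (N J)⁻¹)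
        (-2 * ζ - 4 * η) :=
      ((oM.mul (((isPolyO_const (2 * Vf)).mono hη.le).add (oLc.const_mul 2))).mul
        isPolyO_inv).mono (by linarith)
    refine (((((oA.add e1).add oρ).mul (obi.mul obi)).mono (e' := -4 * η)
      (by linarith))).congr_left fun J => ?_
    have := (hNpos J).ne'
    have := (hb_pos J).ne'
    simp only [hEdef]
    field_simp
    ring
  have oT : IsPolyO T (-2 * η) := by
    have e1 : IsPolyO (fun J => Ck ^ 2 / (N J * b J ^ 2)) (-1 + (ζ + ζ)) := by
      refine ((isPolyO_inv.mul (obi.mul obi)).const_mul (Ck ^ 2)).congr_left fun J => ?_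
      have := (hNpos J).ne'
      have := (hb_pos J).ne'
      simp only [hN]
      field_simp
    have e2 : IsPolyO (fun J => L J ^ 2) (η + η) := (oL.mul oL).congr_left fun J => (sq _).symm
    have e3 : IsPolyO (fun J => Ck / b J * τ J) (ζ + -1) :=
      ((obi.const_mul Ck).mul oτ).congr_left fun J => by rw [← div_eq_mul_inv]
    exact ((e2.mul (olog.mul e1).sqrt).mono (by linarith)).add (e3.mono (by linarith))
  have oerr : IsPolyO err (-2 * η) := by
    have e2 : IsPolyO (fun J => L J ^ 2) (2 * η) :=
      ((oL.mul oL).mono (by linarith)).congr_left fun J => (sq _).symm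
    have e3 : IsPolyO (fun J => Ck * (2 * L J + (L J + 2 * A₀)) + (L J ^ 2 + hm) * Lk) (2 * η) :=
      ((((oL.const_mul 2).add oLc).const_mul Ck).mono (by linarith)).add
        (((e2.add ((isPolyO_const hm).mono (by linarith))).mul
          (isPolyO_const (Lk : ℝ))).mono (by linarith))
    exact ((((e3.mul oE).mono (by linarith)).add oT).const_mul _).add
      ((ob.mono (by linarith)).const_mul _)
  -- The n⁻² term alone dominates the probability, so any positive ς would do.
  refine ⟨1, one_pos, p + 6, ?_⟩
  filter_upwards [hδ, oerr.eventually_lt_log (by linarith) hc v, hdesign, hpO.bound,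
    (oE.const_mul (Lk : ℝ)).tendsto_zero (by linarith) |>.eventually_le_const (half_pos hc₁),
    (ob.tendsto_zero (by linarith)).eventually_le_const one_pos, eventually_ge_atTop 1]
    with J hδJ herrJ hdesJ hpJ hEJ hbJ hJ1 q hq
  have hcast : ((2 ^ J : ℕ) : ℝ) = N J := by simp [hN]
  obtain ⟨f, hf, hfm, haf⟩ := hmod (2 ^ J)
  have hu := h11 J q hq
  have hmeas := hmodel.measurable J
  have hLJ : 0 < L J :=
    mul_pos ha (Real.rpow_pos_of_pos (Real.log_pos (one_lt_pow₀ one_lt_two (by omega))) _)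
  have hmeasG : MeasurableSet {ω | ∀ t ∈ Finset.Icc 1 (2 ^ J),
      |X J t ω - gridValues α (2 ^ J) t| ≤ L J} := by
    have : {ω | ∀ t ∈ Finset.Icc 1 (2 ^ J), |X J t ω - gridValues α (2 ^ J) t| ≤ L J} =
        ⋂ t ∈ Finset.Icc 1 (2 ^ J), {ω | |X J t ω - gridValues α (2 ^ J) t| ≤ L J} := by
      ext ω; simp
    rw [this]
    refine Finset.measurableSet_biInter _ fun t ht => ?_
    exact measurableSet_le ((hmeas t ht).sub_const _).abs measurable_const
  have hvar : ∀ t ∈ Finset.Icc 1 (2 ^ J),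
      ∫ ω, (X J t ω - gridValues α (2 ^ J) t) ^ 2 ∂(P J) = h (gridValues α (2 ^ J) t) := by
    intro t ht
    rw [← hmodel.variance J t ht, variance_eq_integral (hmeas t ht).aemeasurable,
      hmodel.mean J t ht]
  have hmom4 := fun t ht => hmom J t ht 4 (by norm_num)
  have hpow : ∀ t ω, |noise α X J t ω| ^ 4 = ((X J t ω - gridValues α (2 ^ J) t) ^ 2) ^ 2 := by
    intro t ω
    rw [← pow_mul, noise, ← abs_pow, abs_of_nonneg]
    positivity
  simp only [hpow] at hmom4
  have key := measure_hHat_error_le (μ := P J) (n := 2 ^ J) (M := M J) (X := X J)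
    (a := gridValues α (2 ^ J)) (f := f) (w := κ J q.1 q.2) (pad := pad J) (K := K) (h := h)
    (Lk := Lk) (b := b J) (Ck := Ck) (L := L J) (m := m) (p := p) (A₀ := A₀) (Vf := Vf)
    (V := V J) (hm := hm) (H := H) (c₁ := c₁) (A := A J) (ρ := ρ J) (T := T J) (E := E J)
    (by positivity) (hpad J) hmeas (hmodel.indep J)
    (fun t ht => by
      rw [integral_sub ((hmodel.memLp J t ht).integrable one_le_two) (integrable_const _),
        hmodel.mean J t ht]; simp)
    hvar (fun t ht => (hmodel.memLp J t ht).sub (memLp_const _))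
    (fun t ht => (memLp_two_iff_integrable_sq
      (((hmeas t ht).sub_const _).pow_const 2).aestronglyMeasurable).2 (hmom4 t ht).1)
    (fun t ht => by
      rw [hvar t ht]
      exact (hle _ (hgrid _ t ht)).trans (le_add_of_nonneg_right hm₄))
    (fun t ht => (hmom4 t ht).2.trans <| le_add_of_nonneg_of_le hhm0 <|
      mul_le_mul_of_nonneg_left (hle _ (hgrid _ t ht)) (by positivity))
    (by
      rw [hcast, probReal_compl_eq_one_sub hmeasG]
      refine (le_abs_self _).trans (hpJ.trans_eq ?_)
      rw [Real.norm_of_nonneg (by positivity)])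
    hLJ hm0 hp0
    (fun t ht => by
      rw [abs_of_pos (hpos _ (hgrid _ t ht))]
      exact (hsub (hgrid _ t ht)).2)
    hf hfm haf (h5.nonneg J q hq) (h5.sum_one J q hq)
    ((hC₅ J q hq).trans <| mul_le_mul (le_max_left _ _) (scale_le_of_mem_indexSet hq)
      (by positivity) (by positivity))
    (by positivity) (hb_pos J) hbJ h6.nonneg hKC hCk hKL h6.support
    (by rw [abs_of_nonneg (hnn _ hu)]; exact hle _ hu) H.2
    (fun t ht => by
      have := hlip.dist_le_mul _ (hsub (hgrid _ t ht)) _ (hsub hu)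
      rwa [Real.dist_eq, Real.dist_eq] at this)
    hc₁ (hdesJ _ hu) (by rw [hcast]) (by rw [hcast]) (by rw [hcast])
    (by rw [hcast]) hEJ
  rw [hcast] at key
  refine le_trans (measureReal_mono fun ω hω => ?_) (key.trans ?_)
  · exact (herrJ.trans_le hδJ).trans_le hω
  · refine mul_le_mul_of_nonneg_left (le_add_of_nonneg_left ?_) (by positivity)
    exact mul_nonneg (Real.rpow_nonneg (hNpos J).le _) (Real.exp_pos _).le
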